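/- **Systems.** Expressions are $A,B,a,b ::= s \mid x \mid (x:A)\to B \mid \lambda x{:}A.\,b \mid a\,b$ with sorts $s\in\{*,\Box\}$, taken up to renaming of bound variables; $=_\beta$ is the reflexive, symmetric, transitive closure of one-step $\beta$-reduction (in any position). $A\to B$ is the product whose bound variable does not occur in $B$. CC and F$_\omega$ are the pure type systems with the axiom $*:\Box$ and product rules $(s_1,s_2,s_3)\in\mathcal R$, where $\mathcal R=\{(*,*,*),(\Box,*,*),(\Box,\Box,\Box)\}$ for F$_\omega$, and CC has in addition $(*,\Box,\Box)$. The rules are the usual ones: if $\vdash\Gamma$ then $\Gamma\vdash *:\Box$, and $\Gamma\vdash x:A$ for $(x:A)\in\Gamma$; if $\Gamma\vdash A:s_1$, $\Gamma,x{:}A\vdash B:s_2$ and $(s_1,s_2,s_3)\in\mathcal R$ then $\Gamma\vdash (x:A)\to B:s_3$; if $\Gamma\vdash (x:A)\to B:s$ and $\Gamma,x{:}A\vdash b:B$ then $\Gamma\vdash\lambda x{:}A.\,b:(x:A)\to B$; if $\Gamma\vdash a:(x:A)\to B$ and $\Gamma\vdash b:A$ then $\Gamma\vdash a\,b:[b/x]B$;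 if $\Gamma\vdash a:A$, $\Gamma\vdash B:s$ and $A=_\beta B$ then $\Gamma\vdash a:B$; the empty context is well formed, and $\vdash\Gamma,x{:}A$ if $x\notin\mathrm{dom}(\Gamma)$ and $\Gamma\vdash A:s$. In CC, $A$ is a *kind* if $A:\Box$ (in some context), a *$\Gamma$-type* if $\Gamma\vdash A:*$, a *$\Gamma$-constructor* if $\Gamma\vdash A:B$ for some $B$ with $\Gamma\vdash B:\Box$, and a *$\Gamma$-term* if $\Gamma\vdash A:B$ for some $B$ with $\Gamma\vdash B:*$. **Translations.** Fix variables $0$, $z$ and, for each variable $x$, a variable $w^x$, all distinct from each other and from the variables of the source expressions. Let $V(\Box)=V(*)=*$, and $V((x:A)\to B)=V(A)\to V(B)$ if $A$ is a kind, $V((x:A)\to B)=V(B)$ otherwise. The type translation $[\![\cdot]\!]_\Gamma$ is given by - $[\![\Box]\!]_\Gamma=[\![*]\!]_\Gamma=0$ and $[\![x]\!]_\Gamma=x$; - $[\![(x:A)\to B]\!]_\Gamma=(x:V(A))\to[\![A]\!]_\Gamma\to[\![B]\!]_{\Gamma,x:A}$ if $A$ is a kind, and $(x:[\![A]\!]_\Gamma)\to[\![B]\!]_{\Gamma,x:A}$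 if $A$ is a $\Gamma$-type; - $[\![\lambda x{:}A.\,B]\!]_\Gamma=\lambda x{:}V(A).\,[\![B]\!]_{\Gamma,x:A}$ if $A$ is a kind, and $[\![B]\!]_{\Gamma,x:A}$ if $A$ is a $\Gamma$-type; - $[\![A\,B]\!]_\Gamma=[\![A]\!]_\Gamma\,[\![B]\!]_\Gamma$ if $B$ is a $\Gamma$-constructor, and $[\![A]\!]_\Gamma$ if $B$ is a $\Gamma$-term. The translation of contexts is $[\![\cdot]\!] = \big(0:*,\; z:(x:*)\to x\big)$ for the empty context, and $[\![\Gamma,x{:}A]\!]$ is $[\![\Gamma]\!],\,x:V(A),\,w^x:[\![A]\!]_\Gamma$ if $A$ is a kind, and $[\![\Gamma]\!],\,x:[\![A]\!]_\Gamma$ if $A$ is a $\Gamma$-type. Let $c^B=z\,B$ when $B$ is an F$_\omega$ type, and $c^{*}=0$, $c^{(x:A)\to B}=\lambda x{:}A.\,c^B$ for F$_\omega$ kinds. The term translation $[\cdot]_\Gamma$ is given by - $[*]_\Gamma=c^0$; $[x]_\Gamma=w^x$ if $x$ is a $\Gamma$-constructor, and $[x]_\Gamma=x$ if $x$ is a $\Gamma$-term;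 - $[(x:A)\to B]_\Gamma=c^{0\to0\to0}\,[A]_\Gamma\,\big([c^{V(A)}/x][c^{[\![A]\!]_\Gamma}/w^x][B]_{\Gamma,x:A}\big)$ if $A$ is a kind, and $c^{0\to0\to0}\,[A]_\Gamma\,\big([c^{[\![A]\!]_\Gamma}/x][B]_{\Gamma,x:A}\big)$ if $A$ is a $\Gamma$-type; - $[\lambda x{:}A.\,b]_\Gamma=(\lambda y{:}0.\,\lambda x{:}V(A).\,\lambda w^x{:}[\![A]\!]_\Gamma.\,[b]_{\Gamma,x:A})\,[A]_\Gamma$ if $A$ is a kind, and $(\lambda y{:}0.\,\lambda x{:}[\![A]\!]_\Gamma.\,[b]_{\Gamma,x:A})\,[A]_\Gamma$ if $A$ is a $\Gamma$-type, with $y$ fresh; - $[A\,B]_\Gamma=[A]_\Gamma\,[\![B]\!]_\Gamma\,[B]_\Gamma$ if $B$ is a $\Gamma$-constructor, and $[A]_\Gamma\,[B]_\Gamma$ if $B$ is a $\Gamma$-term. **Theorem (Soundness of the term translation).** If $\Gamma\vdash_{CC}a:A$, then $[\![\Gamma]\!]\vdash_{F_\omega}[a]_\Gamma:[\![A]\!]_\Gamma$.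 -/

import Mathlib

/-! Pure type systems over the two sorts `∗` and `□`, with de Bruijn indices: the calculus of
constructions `CC`, the system `Fω`, and the type and term translations from `CC` to `Fω`.

Expressions are taken up to renaming of bound variables, represented by de Bruijn indices.  A
context is a list whose head is the most recent binding, so that index `0` refers to the head. -/

namespace PureTS

/-- The sorts `∗` and `□`. -/
inductive Srt where
  | star : Srt
  | box : Srt

/-- Expressions `s | x | (x : A) → B | λ x : A. b | a b`.  The second argument of `pi` and of
`lam` is under one binder. -/
inductive Expr where
  | sort : Srt → Expr
  | var : ℕ → Expr
  | pi : Expr → Expr → Expr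
  | lam : Expr → Expr → Expr
  | app : Expr → Expr → Expr

/-- A context; the head of the list is the binding added last. -/
abbrev Ctx : Type := List Expr

namespace Expr

/-- Extend a renaming under one binder. -/
def liftRen (ξ : ℕ → ℕ) : ℕ → ℕ
  | 0 => 0
  | n + 1 => ξ n + 1

/-- Renaming of the free variables. -/
def rename : (ℕ → ℕ) → Expr → Expr
  | _, sort s => sort s
  | ξ, var n => var (ξ n)
  | ξ, pi A B => pi (rename ξ A) (rename (liftRen ξ) B)
  | ξ, lam A b => lam (rename ξ A) (rename (liftRen ξ) b)
  | ξ, app a b => app (rename ξ a) (rename ξ b)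

/-- Weakening by one new variable: the same expression, read under one more binding. -/
def shift (a : Expr) : Expr := rename Nat.succ a

/-- Inverse of `shift`: an expression in which the variable `0` does not occur, read with that
binding removed. -/
def lower (a : Expr) : Expr := rename Nat.pred a

/-- Extend a substitution under one binder. -/
def liftSub (σ : ℕ → Expr) : ℕ → Expr
  | 0 => var 0
  | n + 1 => shift (σ n)

/-- Simultaneous (capture-avoiding) substitution. -/
def subst : (ℕ → Expr) → Expr → Expr
  | _, sort s => sort s
  | σ, var n => σ n
  | σ, pi A B => pi (subst σ A) (subst (liftSub σ) B)
  | σ, lam A b => lam (subst σ A) (subst (liftSub σ) b)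
  | σ, app a b => app (subst σ a) (subst σ b)

/-- The substitution that replaces the variable `0` by `a` and lowers all the others. -/
def single (a : Expr) : ℕ → Expr
  | 0 => a
  | n + 1 => var n

/-- `inst b a` is `[a/x] b`, where `x` is the variable `0` of `b`. -/
def inst (b a : Expr) : Expr := subst (single a) b

/-- The non-dependent product `A → B`. -/
def arrow (A B : Expr) : Expr := pi A (shift B)

end Expr

open PureTS.Expr

/-- One-step reduction `a ⇝ b`. -/
inductive Step : Expr → Expr → Prop
  | beta (A b a : Expr) : Step (app (lam A b) a) (inst b a)
  | pi1 {A A' B : Expr} : Step A A' → Step (pi A B) (pi A' B)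
  | pi2 {A B B' : Expr} : Step B B' → Step (pi A B) (pi A B')
  | lam1 {A A' b : Expr} : Step A A' → Step (lam A b) (lam A' b)
  | lam2 {A b b' : Expr} : Step b b' → Step (lam A b) (lam A b')
  | app1 {a a' b : Expr} : Step a a' → Step (app a b) (app a' b)
  | app2 {a b b' : Expr} : Step b b' → Step (app a b) (app a b')

/-- `a =β b`: the reflexive, symmetric, transitive closure of one-step reduction. -/
def Conv : Expr → Expr → Prop := Relation.EqvGen Step

/-- `Lookup Γ n A`: the variable `n` is declared in `Γ`, with type `A` (as an expression over
the whole of `Γ`). -/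
inductive Lookup : Ctx → ℕ → Expr → Prop
  | head (Γ : Ctx) (A : Expr) : Lookup (A :: Γ) 0 (shift A)
  | tail {Γ : Ctx} {n : ℕ} {A : Expr} (B : Expr) :
      Lookup Γ n A → Lookup (B :: Γ) (n + 1) (shift A)

/-- The axioms and the product formation rules of a pure type system on the sorts `∗`, `□`. -/
structure PTS where
  ax : Srt → Srt → Prop
  rule : Srt → Srt → Srt → Prop

mutual

/-- The typing judgement `Γ ⊢ a : A` of a pure type system. -/
inductive HasType (P : PTS) : Ctx → Expr → Expr → Prop
  | sort {Γ : Ctx} {s₁ s₂ : Srt} : WfCtx P Γ → P.ax s₁ s₂ →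
      HasType P Γ (Expr.sort s₁) (Expr.sort s₂)
  | var {Γ : Ctx} {n : ℕ} {A : Expr} : WfCtx P Γ → Lookup Γ n A →
      HasType P Γ (Expr.var n) A
  | pi {Γ : Ctx} {A B : Expr} {s₁ s₂ s₃ : Srt} :
      HasType P Γ A (Expr.sort s₁) → HasType P (A :: Γ) B (Expr.sort s₂) →
      P.rule s₁ s₂ s₃ → HasType P Γ (Expr.pi A B) (Expr.sort s₃)
  | lam {Γ : Ctx} {A B b : Expr} {s : Srt} :
      HasType P Γ (Expr.pi A B) (Expr.sort s) → HasType P (A :: Γ) b B →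
      HasType P Γ (Expr.lam A b) (Expr.pi A B)
  | app {Γ : Ctx} {A B a b : Expr} :
      HasType P Γ a (Expr.pi A B) → HasType P Γ b A →
      HasType P Γ (Expr.app a b) (Expr.inst B b)
  | conv {Γ : Ctx} {a A B : Expr} {s : Srt} :
      HasType P Γ a A → HasType P Γ B (Expr.sort s) → Conv A B → HasType P Γ a B

/-- The judgement `⊢ Γ` that a context is well formed. -/
inductive WfCtx (P : PTS) : Ctx → Prop
  | nil : WfCtx P []
  | cons {Γ : Ctx} {A : Expr} {s : Srt} :
      HasType P Γ A (Expr.sort s) → WfCtx P (A :: Γ)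

end

/-- The only axiom is `∗ : □`. -/
inductive StarBox : Srt → Srt → Prop
  | mk : StarBox .star .box

/-- The product rules of the calculus of constructions. -/
inductive CCRule : Srt → Srt → Srt → Prop
  | sss : CCRule .star .star .star
  | bss : CCRule .box .star .star
  | bbb : CCRule .box .box .box
  | sbb : CCRule .star .box .box

/-- The product rules of `Fω`. -/
inductive FomegaRule : Srt → Srt → Srt → Prop
  | sss : FomegaRule .star .star .star
  | bss : FomegaRule .box .star .star
  | bbb : FomegaRule .box .box .box

/-- The calculus of constructions. -/
def CC : PTS := ⟨StarBox, CCRule⟩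

/-- System `Fω`. -/
def Fomega : PTS := ⟨StarBox, FomegaRule⟩

/-- `A` is a kind of CC: it has type `□` (in some context). -/
def IsKind (A : Expr) : Prop := ∃ Γ : Ctx, HasType CC Γ A (.sort .box)

/-- `A` is a `Γ`-constructor of CC: it has a type `B` in `Γ` which itself has type `□` in `Γ`. -/
def IsConstructor (Γ : Ctx) (A : Expr) : Prop :=
  ∃ B : Expr, HasType CC Γ A B ∧ HasType CC Γ B (.sort .box)

open Classical in
/-- The function `V` from the sorts and kinds of CC to the kinds of `Fω`.  Its values are closed,
so they need no renaming when they are moved from one context to another. -/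
noncomputable def V : Expr → Expr
  | .pi A B => if IsKind A then arrow (V A) (V B) else V B
  | _ => .sort .star

/-! A context `Γ = x₁ : A₁, …, xₙ : Aₙ` is translated to
`0 : ∗, z : (x : ∗) → x`, followed, for each `i`, by `xᵢ : V(Aᵢ), w^{xᵢ} : ⟦Aᵢ⟧` if `Aᵢ` is a kind
and by `xᵢ : ⟦Aᵢ⟧` otherwise.  The next five functions compute the de Bruijn indices, in the
translated context, of the variables `0`, `z`, `xᵢ` and `w^{xᵢ}`. -/

open Classical in
/-- The number of bindings into which a binding `x : A` is translated. -/
noncomputable def width (A : Expr) : ℕ := if IsKind A then 2 else 1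

/-- The index of the variable `z` in the translation of `Γ`. -/
noncomputable def zIdx : Ctx → ℕ
  | [] => 0
  | A :: Γ => zIdx Γ + width A

/-- The index of the type variable `0` in the translation of `Γ`. -/
noncomputable def zeroIdx : Ctx → ℕ
  | [] => 1
  | A :: Γ => zeroIdx Γ + width A

open Classical in
/-- The index, in the translation of `Γ`, of (the copy of) the variable `n` of `Γ`. -/
noncomputable def xIdx : Ctx → ℕ → ℕ
  | [], n => n + 2
  | A :: _, 0 => if IsKind A then 1 else 0
  | A :: Γ, n + 1 => xIdx Γ n + width A

/-- The index, in the translation of `Γ`, of the variable `w^x`, where `x` is the variable `n` of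
`Γ`; it is meaningful when the type of `x` is a kind. -/
noncomputable def wIdx : Ctx → ℕ → ℕ
  | [], n => n + 2
  | _ :: _, 0 => 0
  | A :: Γ, n + 1 => wIdx Γ n + width A

/-- The type variable `0`, in the translation of `Γ`. -/
noncomputable def tyZero (Γ : Ctx) : Expr := .var (zeroIdx Γ)

open Classical in
/-- The type translation `⟦A⟧_Γ`, an expression over the translation of `Γ`.

In the first case for `pi`, the bound variable of the inner (non-dependent) product takes the place
of `w^x`, which does not occur in `⟦B⟧`.  In the cases for `lam`, the variable removed by `lower` is
`w^x`, respectively `x`; it does not occur in `⟦B⟧`. -/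
noncomputable def typeTr : Ctx → Expr → Expr
  | Γ, .sort _ => tyZero Γ
  | Γ, .var n => .var (xIdx Γ n)
  | Γ, .pi A B =>
      if IsKind A then .pi (V A) (.pi (shift (typeTr Γ A)) (typeTr (A :: Γ) B))
      else .pi (typeTr Γ A) (typeTr (A :: Γ) B)
  | Γ, .lam A B =>
      if IsKind A then .lam (V A) (lower (typeTr (A :: Γ) B))
      else lower (typeTr (A :: Γ) B)
  | Γ, .app A B =>
      if IsConstructor Γ B then .app (typeTr Γ A) (typeTr Γ B)
      else typeTr Γ A

open Classical in
/-- The translation of contexts. -/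
noncomputable def ctxTr : Ctx → Ctx
  | [] => [.pi (.sort .star) (.var 0), .sort .star]
  | A :: Γ =>
      if IsKind A then shift (typeTr Γ A) :: V A :: ctxTr Γ
      else typeTr Γ A :: ctxTr Γ

/-- The canonical inhabitant `c^B = z B` of a type `B` of `Fω` over the translation of `Γ`. -/
noncomputable def canonType (Γ : Ctx) (B : Expr) : Expr := .app (.var (zIdx Γ)) B

/-- The canonical inhabitant of a kind of `Fω`, given the index `i` of the type variable `0`:
`c^∗ = 0` and `c^{(x : A) → B} = λ x : A. c^B`. -/
def canonKind : ℕ → Expr → Expr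
  | i, .pi A B => .lam A (canonKind (i + 1) B)
  | i, _ => .var i

/-- The expression `c^{0 → 0 → 0}` over the translation of `Γ`. -/
noncomputable def canonProd (Γ : Ctx) : Expr :=
  canonType Γ (arrow (tyZero Γ) (arrow (tyZero Γ) (tyZero Γ)))

open Classical in
/-- The term translation `[a]_Γ`, an expression over the translation of `Γ`.

In the cases for `pi`, `inst` substitutes `c^{⟦A⟧}` for `w^x` and then `c^{V(A)}` for `x`,
respectively `c^{⟦A⟧}` for `x`.  In the cases for `lam`, the outermost abstraction binds the fresh
variable `y`, whence the `shift` of its body.  The sort `□` has no type in CC; its translation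
plays no role. -/
noncomputable def termTr : Ctx → Expr → Expr
  | Γ, .sort _ => canonType Γ (tyZero Γ)
  | Γ, .var n => if IsConstructor Γ (.var n) then .var (wIdx Γ n) else .var (xIdx Γ n)
  | Γ, .pi A B =>
      if IsKind A then
        .app (.app (canonProd Γ) (termTr Γ A))
          (inst (inst (termTr (A :: Γ) B) (shift (canonType Γ (typeTr Γ A))))
            (canonKind (zeroIdx Γ) (V A)))
      else
        .app (.app (canonProd Γ) (termTr Γ A))
          (inst (termTr (A :: Γ) B) (canonType Γ (typeTr Γ A)))
  | Γ, .lam A b =>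
      if IsKind A then
        .app (.lam (tyZero Γ)
          (shift (.lam (V A) (.lam (shift (typeTr Γ A)) (termTr (A :: Γ) b))))) (termTr Γ A)
      else
        .app (.lam (tyZero Γ) (shift (.lam (typeTr Γ A) (termTr (A :: Γ) b)))) (termTr Γ A)
  | Γ, .app A B =>
      if IsConstructor Γ B then .app (.app (termTr Γ A) (typeTr Γ B)) (termTr Γ B)
      else .app (termTr Γ A) (termTr Γ B)

end PureTS

-- The type translation erases the dependence of types and constructors on terms, so the product
-- rule that CC has beyond Fω is not needed in the target. A constructor variable is doubled: the
-- copy `x` is used inside translated types, and `w^x` stands for it where it is treated as a term.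
-- Granted three facts about `⟦·⟧`, the theorem is checked construct by construct: `⟦·⟧` commutes
-- with substitution, it sends convertible well-typed types and kinds to convertible types, and it
-- sends a constructor of kind `K` to a constructor of kind `V(K)`, and types and kinds to types.
-- Where a translated expression must leave the scope of `x` and `w^x`, canonical inhabitants are
-- substituted for them.
--
-- The obstacle is that the translations branch on typability (`IsKind`, `IsConstructor`), which
-- does not compute under substitution or reduction. The syntactic tests `endsInStar` and `level`
-- agree with them on well-typed expressions (`level_eq`); this rests on uniqueness of types and
-- subject reduction in CC, hence on Church–Rosser for raw expressions. The function `tr` uses these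
-- tests and reads its variables from an environment. Substitution in the source and in the target
-- then both become operations on environments (`tr_subst`, `tr_map`), and the values of term
-- variables are irrelevant (`tr_congr`). A β-step at constructor level is therefore sent to a
-- β-step if the argument is a constructor and to an identity if it is a term (`tr_step`).
--
-- Both soundness results, `tr_type` and `termTr_type`, are inductions on the expression: generation
-- supplies one type of it, and invariance of the translated type under conversion passes to the
-- given one.

namespace PureTS

namespace Expr

/-! ### The substitution calculus -/

theorem liftSub_var_comp (ξ : ℕ → ℕ) :
    liftSub (fun n => var (ξ n)) = fun n => var (liftRen ξ n) := by
  funext n; cases n <;> rfl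

theorem liftSub_var : liftSub var = var := by
  funext n; cases n <;> rfl

theorem rename_eq_subst (ξ : ℕ → ℕ) (a : Expr) :
    rename ξ a = subst (fun n => var (ξ n)) a := by
  induction a generalizing ξ <;> simp_all [rename, subst, liftSub_var_comp]

theorem subst_var (a : Expr) : subst var a = a := by
  induction a <;> simp_all [subst, liftSub_var]

theorem subst_rename (σ : ℕ → Expr) (ξ : ℕ → ℕ) (a : Expr) :
    subst σ (rename ξ a) = subst (fun n => σ (ξ n)) a := by
  have h (σ : ℕ → Expr) (ξ : ℕ → ℕ) :
      (fun n => liftSub σ (liftRen ξ n)) = liftSub (fun n => σ (ξ n)) := by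
    funext n; cases n <;> rfl
  induction a generalizing σ ξ <;> simp_all [rename, subst]

theorem rename_rename (ζ ξ : ℕ → ℕ) (a : Expr) :
    rename ζ (rename ξ a) = rename (fun n => ζ (ξ n)) a := by
  rw [rename_eq_subst, subst_rename, rename_eq_subst]

theorem rename_subst (ξ : ℕ → ℕ) (σ : ℕ → Expr) (a : Expr) :
    rename ξ (subst σ a) = subst (fun n => rename ξ (σ n)) a := by
  have h (ξ : ℕ → ℕ) (σ : ℕ → Expr) :
      (fun n => rename (liftRen ξ) (liftSub σ n)) = liftSub (fun n => rename ξ (σ n)) := by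
    funext n
    cases n with
    | zero => rfl
    | succ n => simp only [liftSub, shift, rename_rename]; rfl
  induction a generalizing ξ σ <;> simp_all [rename, subst]

theorem liftSub_subst (τ σ : ℕ → Expr) :
    (fun n => subst (liftSub τ) (liftSub σ n)) = liftSub (fun n => subst τ (σ n)) := by
  funext n
  cases n with
  | zero => rfl
  | succ n => simp only [liftSub, shift, subst_rename, rename_subst]

theorem subst_subst (τ σ : ℕ → Expr) (a : Expr) :
    subst τ (subst σ a) = subst (fun n => subst τ (σ n)) a := by
  induction a generalizing τ σ <;> simp_all [subst, liftSub_subst]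

theorem subst_liftSub_shift (σ : ℕ → Expr) (a : Expr) :
    subst (liftSub σ) (shift a) = shift (subst σ a) := by
  simp only [shift, subst_rename, rename_subst]; rfl

theorem subst_single_shift (a b : Expr) : subst (single b) (shift a) = a := by
  rw [shift, subst_rename]; exact subst_var a

theorem inst_shift (a b : Expr) : inst (shift a) b = a := subst_single_shift a b

theorem subst_inst (σ : ℕ → Expr) (b a : Expr) :
    subst σ (inst b a) = inst (subst (liftSub σ) b) (subst σ a) := by
  simp only [inst, subst_subst]
  congr 1
  funext n
  cases n with
  | zero => rfl
  | succ n => exact (inst_shift _ _).symm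

theorem rename_liftRen_shift (ξ : ℕ → ℕ) (a : Expr) :
    rename (liftRen ξ) (shift a) = shift (rename ξ a) := by
  simp only [shift, rename_rename]; rfl

theorem rename_inst (ξ : ℕ → ℕ) (b a : Expr) :
    rename ξ (inst b a) = inst (rename (liftRen ξ) b) (rename ξ a) := by
  simp only [rename_eq_subst, subst_inst, liftSub_var_comp]

end Expr

open PureTS.Expr

/-! ### Parallel reduction and confluence -/

/-- Parallel reduction. -/
inductive Par : Expr → Expr → Prop
  | sort (s : Srt) : Par (.sort s) (.sort s)
  | var (n : ℕ) : Par (.var n) (.var n)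
  | pi {A A' B B' : Expr} : Par A A' → Par B B' → Par (.pi A B) (.pi A' B')
  | lam {A A' b b' : Expr} : Par A A' → Par b b' → Par (.lam A b) (.lam A' b')
  | app {a a' b b' : Expr} : Par a a' → Par b b' → Par (.app a b) (.app a' b')
  | beta (A : Expr) {b b' a a' : Expr} :
      Par b b' → Par a a' → Par (.app (.lam A b) a) (inst b' a')

namespace Par

theorem refl (a : Expr) : Par a a := by
  induction a with
  | sort s => exact .sort s
  | var n => exact .var n
  | pi A B hA hB => exact .pi hA hB
  | lam A b hA hb => exact .lam hA hb
  | app a b ha hb => exact .app ha hb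

theorem of_step {a b : Expr} (h : Step a b) : Par a b := by
  induction h with
  | beta A b a => exact .beta A (refl b) (refl a)
  | pi1 _ ih => exact .pi ih (refl _)
  | pi2 _ ih => exact .pi (refl _) ih
  | lam1 _ ih => exact .lam ih (refl _)
  | lam2 _ ih => exact .lam (refl _) ih
  | app1 _ ih => exact .app ih (refl _)
  | app2 _ ih => exact .app (refl _) ih

theorem rename {a b : Expr} (h : Par a b) (ξ : ℕ → ℕ) :
    Par (Expr.rename ξ a) (Expr.rename ξ b) := by
  induction h generalizing ξ with
  | sort s => exact .sort s
  | var n => exact .var _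
  | pi _ _ h₁ h₂ => exact .pi (h₁ _) (h₂ _)
  | lam _ _ h₁ h₂ => exact .lam (h₁ _) (h₂ _)
  | app _ _ h₁ h₂ => exact .app (h₁ _) (h₂ _)
  | beta A _ _ h₁ h₂ => rw [rename_inst]; exact .beta _ (h₁ _) (h₂ _)

theorem liftSub {σ τ : ℕ → Expr} (h : ∀ n, Par (σ n) (τ n)) (n : ℕ) :
    Par (Expr.liftSub σ n) (Expr.liftSub τ n) := by
  cases n with
  | zero => exact .var 0
  | succ n => exact (h n).rename _

theorem subst {a b : Expr} (h : Par a b) {σ τ : ℕ → Expr} (hσ : ∀ n, Par (σ n) (τ n)) :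
    Par (Expr.subst σ a) (Expr.subst τ b) := by
  induction h generalizing σ τ with
  | sort s => exact .sort s
  | var n => exact hσ n
  | pi _ _ h₁ h₂ => exact .pi (h₁ hσ) (h₂ (liftSub hσ))
  | lam _ _ h₁ h₂ => exact .lam (h₁ hσ) (h₂ (liftSub hσ))
  | app _ _ h₁ h₂ => exact .app (h₁ hσ) (h₂ hσ)
  | beta A _ _ h₁ h₂ => rw [subst_inst]; exact .beta _ (h₁ (liftSub hσ)) (h₂ hσ)

theorem inst {b b' a a' : Expr} (hb : Par b b') (ha : Par a a') :
    Par (Expr.inst b a) (Expr.inst b' a') := by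
  refine hb.subst fun n => ?_
  cases n with
  | zero => exact ha
  | succ n => exact .var n

end Par

/-- The complete development of an expression. -/
def develop : Expr → Expr
  | .sort s => .sort s
  | .var n => .var n
  | .pi A B => .pi (develop A) (develop B)
  | .lam A b => .lam (develop A) (develop b)
  | .app (.lam _ b) a => inst (develop b) (develop a)
  | .app a b => .app (develop a) (develop b)

/-- Takahashi's argument: `develop a` contracts every redex of `a`, so whatever a parallel step has
left undone can still be done. The target depends on `a` alone, which gives the diamond property. -/
theorem Par.triangle {a b : Expr} (h : Par a b) : Par b (develop a) := by
  induction h with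
  | sort s => exact .sort s
  | var n => exact .var n
  | pi _ _ h₁ h₂ => exact .pi h₁ h₂
  | lam _ _ h₁ h₂ => exact .lam h₁ h₂
  | beta A _ _ h₁ h₂ => exact h₁.inst h₂
  | @app a a' b b' h _ h₁ h₂ =>
    -- `develop` contracts an application exactly when its function part is an abstraction, so that
    -- case is separated.
    cases a with
    | lam A c =>
      cases h with
      | lam hA hc =>
        cases h₁ with
        | lam _ h₁ => exact .beta _ h₁ h₂
    | _ => exact .app h₁ h₂

/-- Many-step reduction. -/
abbrev Red : Expr → Expr → Prop := Relation.ReflTransGen Step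

namespace Red

theorem map {f : Expr → Expr} (hf : ∀ {a b}, Step a b → Step (f a) (f b)) {a b : Expr}
    (h : Red a b) : Red (f a) (f b) := by
  induction h with
  | refl => exact .refl
  | tail _ h ih => exact ih.tail (hf h)

theorem of_par {a b : Expr} (h : Par a b) : Red a b := by
  induction h with
  | sort s => exact .refl
  | var n => exact .refl
  | pi _ _ h₁ h₂ => exact (map (f := fun x => .pi x _) .pi1 h₁).trans (map .pi2 h₂)
  | lam _ _ h₁ h₂ => exact (map (f := fun x => .lam x _) .lam1 h₁).trans (map .lam2 h₂)
  | app _ _ h₁ h₂ => exact (map (f := fun x => .app x _) .app1 h₁).trans (map .app2 h₂)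
  | beta A _ _ h₁ h₂ =>
    exact ((map (f := fun x => .app (.lam A x) _) (fun h => .app1 (.lam2 h)) h₁).trans
      (map .app2 h₂)).tail (.beta _ _ _)

theorem confluent {a b c : Expr} (hb : Red a b) (hc : Red a c) :
    ∃ d, Red b d ∧ Red c d := by
  have par {x y : Expr} (h : Red x y) : Relation.ReflTransGen Par x y := by
    induction h with
    | refl => exact .refl
    | tail _ h ih => exact ih.tail (.of_step h)
  have red {x y : Expr} (h : Relation.ReflTransGen Par x y) : Red x y := by
    induction h with
    | refl => exact .refl
    | tail _ h ih => exact ih.trans (of_par h)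
  obtain ⟨d, hd, hd'⟩ := Relation.church_rosser
    (fun a b c hb hc => ⟨develop a, .single hb.triangle, .single hc.triangle⟩) (par hb) (par hc)
  exact ⟨d, red hd, red hd'⟩

theorem conv {a b : Expr} (h : Red a b) : Conv a b := by
  induction h with
  | refl => exact .refl _
  | tail _ h ih => exact .trans _ _ _ ih (.rel _ _ h)

theorem sort_left {s : Srt} {a : Expr} (h : Red (.sort s) a) : a = .sort s := by
  induction h with
  | refl => rfl
  | tail _ h ih => subst ih; cases h

theorem pi_left {A B c : Expr} (h : Red (.pi A B) c) :
    ∃ A' B', c = .pi A' B' ∧ Red A A' ∧ Red B B' := by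
  induction h with
  | refl => exact ⟨A, B, rfl, .refl, .refl⟩
  | tail _ h ih =>
    obtain ⟨A', B', rfl, hA, hB⟩ := ih
    cases h with
    | pi1 h => exact ⟨_, _, rfl, hA.tail h, hB⟩
    | pi2 h => exact ⟨_, _, rfl, hA, hB.tail h⟩

end Red

-- Church–Rosser and the injectivity of products

namespace Conv

theorem refl (a : Expr) : Conv a a := Relation.EqvGen.refl a

theorem symm {a b : Expr} (h : Conv a b) : Conv b a := Relation.EqvGen.symm _ _ h

theorem trans {a b c : Expr} (h : Conv a b) (h' : Conv b c) : Conv a c :=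
  Relation.EqvGen.trans _ _ _ h h'

theorem of_step {a b : Expr} (h : Step a b) : Conv a b := Relation.EqvGen.rel _ _ h

theorem map {f : Expr → Expr} (hf : ∀ {a b}, Step a b → Step (f a) (f b)) {a b : Expr}
    (h : Conv a b) : Conv (f a) (f b) := by
  induction h with
  | rel _ _ h => exact of_step (hf h)
  | refl _ => exact refl _
  | symm _ _ _ ih => exact ih.symm
  | trans _ _ _ _ _ ih ih' => exact ih.trans ih'

theorem church_rosser {a b : Expr} (h : Conv a b) : ∃ c, Red a c ∧ Red b c := by
  induction h with
  | rel _ _ h => exact ⟨_, .single h, .refl⟩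
  | refl _ => exact ⟨_, .refl, .refl⟩
  | symm _ _ _ ih => exact ih.imp fun _ h => h.symm
  | trans _ _ _ _ _ ih ih' =>
    obtain ⟨c, h₁, h₂⟩ := ih
    obtain ⟨d, h₃, h₄⟩ := ih'
    obtain ⟨e, h₅, h₆⟩ := Red.confluent h₂ h₃
    exact ⟨e, h₁.trans h₅, h₄.trans h₆⟩

theorem pi {A A' B B' : Expr} (hA : Conv A A') (hB : Conv B B') :
    Conv (.pi A B) (.pi A' B') :=
  (map (f := fun x => .pi x _) .pi1 hA).trans (map .pi2 hB)

theorem lam {A A' b b' : Expr} (hA : Conv A A') (hb : Conv b b') :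
    Conv (.lam A b) (.lam A' b') :=
  (map (f := fun x => .lam x _) .lam1 hA).trans (map .lam2 hb)

theorem app {a a' b b' : Expr} (ha : Conv a a') (hb : Conv b b') :
    Conv (.app a b) (.app a' b') :=
  (map (f := fun x => .app x _) .app1 ha).trans (map .app2 hb)

theorem red_sort {a : Expr} {s : Srt} (h : Conv a (.sort s)) : Red a (.sort s) := by
  obtain ⟨c, h₁, h₂⟩ := h.church_rosser
  rwa [h₂.sort_left] at h₁

theorem sort_inj {s t : Srt} (h : Conv (.sort s) (.sort t)) : s = t := by
  have := h.red_sort.sort_left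
  injection this with h; exact h.symm

theorem not_sort_pi {s : Srt} {A B : Expr} (h : Conv (.sort s) (.pi A B)) : False := by
  obtain ⟨A', B', h, -⟩ := h.symm.red_sort.pi_left
  cases h

theorem pi_inj {A A' B B' : Expr} (h : Conv (.pi A B) (.pi A' B')) :
    Conv A A' ∧ Conv B B' := by
  obtain ⟨c, h₁, h₂⟩ := h.church_rosser
  obtain ⟨A₁, B₁, rfl, hA, hB⟩ := h₁.pi_left
  obtain ⟨A₂, B₂, e, hA', hB'⟩ := h₂.pi_left
  cases e
  exact ⟨hA.conv.trans hA'.conv.symm, hB.conv.trans hB'.conv.symm⟩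

theorem of_par {a b : Expr} (h : Par a b) : Conv a b := (Red.of_par h).conv

theorem subst {a b : Expr} (h : Conv a b) (σ : ℕ → Expr) :
    Conv (Expr.subst σ a) (Expr.subst σ b) := by
  induction h with
  | rel _ _ h => exact of_par ((Par.of_step h).subst fun n => .refl _)
  | refl _ => exact refl _
  | symm _ _ _ ih => exact ih.symm
  | trans _ _ _ _ _ ih ih' => exact ih.trans ih'

theorem rename {a b : Expr} (h : Conv a b) (ξ : ℕ → ℕ) :
    Conv (Expr.rename ξ a) (Expr.rename ξ b) := by
  simpa only [rename_eq_subst] using h.subst _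

theorem inst_step (B : Expr) {b b' : Expr} (h : Step b b') : Conv (inst B b) (inst B b') :=
  of_par ((Par.refl B).inst (.of_step h))

end Conv

/-! ### Metatheory of pure type systems -/

/-- Induction on typing derivations, without the well-formedness of contexts. -/
theorem HasType.induction {P : PTS} {motive : ∀ Γ a A, HasType P Γ a A → Prop}
    (sort : ∀ {Γ s₁ s₂} (hΓ : WfCtx P Γ) (h : P.ax s₁ s₂), motive Γ _ _ (.sort hΓ h))
    (var : ∀ {Γ n A} (hΓ : WfCtx P Γ) (h : Lookup Γ n A), motive Γ _ _ (.var hΓ h))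
    (pi : ∀ {Γ A B s₁ s₂ s₃} (hA : HasType P Γ A (.sort s₁))
      (hB : HasType P (A :: Γ) B (.sort s₂)) (h : P.rule s₁ s₂ s₃),
      motive Γ _ _ hA → motive (A :: Γ) _ _ hB → motive Γ _ _ (.pi hA hB h))
    (lam : ∀ {Γ A B b s} (h : HasType P Γ (.pi A B) (.sort s)) (hb : HasType P (A :: Γ) b B),
      motive Γ _ _ h → motive (A :: Γ) _ _ hb → motive Γ _ _ (.lam h hb))
    (app : ∀ {Γ A B a b} (ha : HasType P Γ a (.pi A B)) (hb : HasType P Γ b A),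
      motive Γ _ _ ha → motive Γ _ _ hb → motive Γ _ _ (.app ha hb))
    (conv : ∀ {Γ a A B s} (ha : HasType P Γ a A) (hB : HasType P Γ B (.sort s)) (c : Conv A B),
      motive Γ _ _ ha → motive Γ _ _ hB → motive Γ _ _ (.conv ha hB c))
    {Γ : Ctx} {a A : Expr} (h : HasType P Γ a A) : motive Γ a A h :=
  HasType.rec (P := P) (motive_1 := motive) (motive_2 := fun _ _ => True)
    (fun h h' _ => sort h h') (fun h h' _ => var h h') (fun h h' r ih ih' => pi h h' r ih ih')
    (fun h h' ih ih' => lam h h' ih ih') (fun h h' ih ih' => app h h' ih ih')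
    (fun h h' c ih ih' => conv h h' c ih ih') trivial (fun _ _ => trivial) h

theorem HasType.wfCtx {P : PTS} {Γ : Ctx} {a A : Expr} (h : HasType P Γ a A) : WfCtx P Γ := by
  induction h using HasType.induction <;> assumption

theorem WfCtx.head {P : PTS} {Γ : Ctx} {A : Expr} (h : WfCtx P (A :: Γ)) :
    ∃ s, HasType P Γ A (.sort s) := by
  cases h with
  | cons h => exact ⟨_, h⟩

theorem WfCtx.tail {P : PTS} {Γ : Ctx} {A : Expr} (h : WfCtx P (A :: Γ)) : WfCtx P Γ :=
  h.head.choose_spec.wfCtx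

theorem Lookup.unique {Γ : Ctx} {n : ℕ} {A B : Expr} (h : Lookup Γ n A) (h' : Lookup Γ n B) :
    A = B := by
  induction h generalizing B with
  | head => cases h'; rfl
  | tail _ _ ih =>
    cases h' with
    | tail _ h' => rw [ih h']

namespace HasType

variable {P : PTS} {Γ Δ : Ctx}

/-! #### Generation -/

theorem sort_inv {s : Srt} {T : Expr} (h : HasType P Γ (.sort s) T) :
    ∃ s', P.ax s s' ∧ Conv (.sort s') T := by
  generalize e : Expr.sort s = a at h
  induction h using HasType.induction with
  | sort _ h => cases e; exact ⟨_, h, .refl _⟩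
  | conv _ _ c ih _ =>
    obtain ⟨s', h, c'⟩ := ih e
    exact ⟨s', h, c'.trans c⟩
  | _ => cases e

theorem var_inv {n : ℕ} {T : Expr} (h : HasType P Γ (.var n) T) :
    ∃ A, Lookup Γ n A ∧ Conv A T := by
  generalize e : Expr.var n = a at h
  induction h using HasType.induction with
  | var _ h => cases e; exact ⟨_, h, .refl _⟩
  | conv _ _ c ih _ =>
    obtain ⟨A, h, c'⟩ := ih e
    exact ⟨A, h, c'.trans c⟩
  | _ => cases e

theorem pi_inv {A B T : Expr} (h : HasType P Γ (.pi A B) T) :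
    ∃ s₁ s₂ s₃, HasType P Γ A (.sort s₁) ∧ HasType P (A :: Γ) B (.sort s₂) ∧
      P.rule s₁ s₂ s₃ ∧ Conv (.sort s₃) T := by
  generalize e : Expr.pi A B = a at h
  induction h using HasType.induction with
  | pi hA hB r _ _ => cases e; exact ⟨_, _, _, hA, hB, r, .refl _⟩
  | conv _ _ c ih _ =>
    obtain ⟨s₁, s₂, s₃, hA, hB, r, c'⟩ := ih e
    exact ⟨s₁, s₂, s₃, hA, hB, r, c'.trans c⟩
  | _ => cases e

theorem lam_inv {A b T : Expr} (h : HasType P Γ (.lam A b) T) :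
    ∃ B s, HasType P Γ (.pi A B) (.sort s) ∧ HasType P (A :: Γ) b B ∧ Conv (.pi A B) T := by
  generalize e : Expr.lam A b = a at h
  induction h using HasType.induction with
  | lam hA hb _ _ => cases e; exact ⟨_, _, hA, hb, .refl _⟩
  | conv _ _ c ih _ =>
    obtain ⟨B, s, hA, hb, c'⟩ := ih e
    exact ⟨B, s, hA, hb, c'.trans c⟩
  | _ => cases e

theorem app_inv {a b T : Expr} (h : HasType P Γ (.app a b) T) :
    ∃ A B, HasType P Γ a (.pi A B) ∧ HasType P Γ b A ∧ Conv (inst B b) T := by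
  generalize e : Expr.app a b = c at h
  induction h using HasType.induction with
  | app ha hb _ _ => cases e; exact ⟨_, _, ha, hb, .refl _⟩
  | conv _ _ c ih _ =>
    obtain ⟨A, B, ha, hb, c'⟩ := ih e
    exact ⟨A, B, ha, hb, c'.trans c⟩
  | _ => cases e

/-! #### Weakening and substitution -/

theorem rename {a A : Expr} (h : HasType P Γ a A) {ξ : ℕ → ℕ}
    (hξ : ∀ n B, Lookup Γ n B → Lookup Δ (ξ n) (Expr.rename ξ B)) (hΔ : WfCtx P Δ) :
    HasType P Δ (Expr.rename ξ a) (Expr.rename ξ A) := by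
  have lift {Γ Δ : Ctx} {ξ : ℕ → ℕ} (A : Expr)
      (hξ : ∀ n B, Lookup Γ n B → Lookup Δ (ξ n) (Expr.rename ξ B)) (n : ℕ) (B : Expr)
      (h : Lookup (A :: Γ) n B) :
      Lookup (Expr.rename ξ A :: Δ) (liftRen ξ n) (Expr.rename (liftRen ξ) B) := by
    cases h with
    | head => rw [rename_liftRen_shift]; exact .head _ _
    | tail _ h => rw [rename_liftRen_shift]; exact .tail _ (hξ _ _ h)
  induction h using HasType.induction generalizing Δ ξ with
  | sort _ h => exact .sort hΔ h
  | var _ h => exact .var hΔ (hξ _ _ h)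
  | pi _ _ r ihA ihB => exact .pi (ihA hξ hΔ) (ihB (lift _ hξ) (.cons (ihA hξ hΔ))) r
  | lam _ _ ihA ihb =>
    have h := ihA hξ hΔ
    -- The rule for abstractions types only the whole product; generation on its renamed form
    -- recovers the domain, needed to extend `Δ`.
    obtain ⟨s₁, -, -, hA, -⟩ := pi_inv h
    exact .lam h (ihb (lift _ hξ) (.cons hA))
  | app _ _ iha ihb => rw [rename_inst]; exact .app (iha hξ hΔ) (ihb hξ hΔ)
  | conv _ _ c ih ih' => exact .conv (ih hξ hΔ) (ih' hξ hΔ) (c.rename _)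

theorem weaken {a A B : Expr} (h : HasType P Γ a A) (hΓ : WfCtx P (B :: Γ)) :
    HasType P (B :: Γ) (shift a) (shift A) :=
  h.rename (fun _ _ h => .tail _ h) hΓ

theorem subst {a A : Expr} (h : HasType P Γ a A) {σ : ℕ → Expr}
    (hσ : ∀ n B, Lookup Γ n B → HasType P Δ (σ n) (Expr.subst σ B)) (hΔ : WfCtx P Δ) :
    HasType P Δ (Expr.subst σ a) (Expr.subst σ A) := by
  have lift {Γ Δ : Ctx} {σ : ℕ → Expr} (A : Expr)
      (hσ : ∀ n B, Lookup Γ n B → HasType P Δ (σ n) (Expr.subst σ B))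
      (hΔ : WfCtx P (Expr.subst σ A :: Δ)) (n : ℕ) (B : Expr) (h : Lookup (A :: Γ) n B) :
      HasType P (Expr.subst σ A :: Δ) (liftSub σ n) (Expr.subst (liftSub σ) B) := by
    cases h with
    | head => rw [subst_liftSub_shift]; exact .var hΔ (.head _ _)
    | tail _ h => rw [subst_liftSub_shift]; exact (hσ _ _ h).weaken hΔ
  induction h using HasType.induction generalizing Δ σ with
  | sort _ h => exact .sort hΔ h
  | var _ h => exact hσ _ _ h
  | pi _ _ r ihA ihB =>
    have h := ihA hσ hΔ
    exact .pi h (ihB (lift _ hσ (.cons h)) (.cons h)) r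
  | lam _ _ ihA ihb =>
    have h := ihA hσ hΔ
    obtain ⟨s₁, -, -, hA, -⟩ := pi_inv h
    exact .lam h (ihb (lift _ hσ (.cons hA)) (.cons hA))
  | app _ _ iha ihb => rw [subst_inst]; exact .app (iha hσ hΔ) (ihb hσ hΔ)
  | conv _ _ c ih ih' => exact .conv (ih hσ hΔ) (ih' hσ hΔ) (c.subst _)

theorem inst {a b A B : Expr} (h : HasType P (A :: Γ) b B) (ha : HasType P Γ a A) :
    HasType P Γ (Expr.inst b a) (Expr.inst B a) := by
  refine h.subst (fun n C hC => ?_) ha.wfCtx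
  cases hC with
  | head => rwa [subst_single_shift]
  | tail _ h => rw [subst_single_shift]; exact .var ha.wfCtx h

/-- The identity is a well-typed substitution between the two contexts: the variable `0`, declared
with type `B`, gets type `A` by the conversion rule. -/
theorem ctx_conv {a A B C : Expr} {s s' : Srt} (h : HasType P (A :: Γ) a C)
    (hA : HasType P Γ A (.sort s)) (hB : HasType P Γ B (.sort s')) (c : Conv A B) :
    HasType P (B :: Γ) a C := by
  have hΓ : WfCtx P (B :: Γ) := .cons hB
  rw [← subst_var a, ← subst_var C]
  refine h.subst (fun n D hD => ?_) hΓ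
  rw [subst_var]
  cases hD with
  | head => exact .conv (.var hΓ (.head _ _)) (hA.weaken hΓ) (c.symm.rename _)
  | tail _ h => exact .var hΓ (.tail _ h)

end HasType

theorem WfCtx.lookup {P : PTS} {Γ : Ctx} {n : ℕ} {A : Expr} (hΓ : WfCtx P Γ)
    (h : Lookup Γ n A) : ∃ s, HasType P Γ A (.sort s) := by
  induction h with
  | head =>
    obtain ⟨s, h⟩ := hΓ.head
    exact ⟨s, h.weaken hΓ⟩
  | tail _ _ ih =>
    obtain ⟨s, h⟩ := ih hΓ.tail
    exact ⟨s, h.weaken hΓ⟩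

/-! ### Metatheory of the calculus of constructions -/

theorem CCRule.eq {s₁ s₂ s₃ : Srt} (h : CCRule s₁ s₂ s₃) : s₂ = s₃ := by
  cases h <;> rfl

/-- Products in CC are subject to no restriction on sorts, and the product takes the sort of its
codomain. -/
theorem CCRule.intro (s₁ s₂ : Srt) : CCRule s₁ s₂ s₂ := by
  cases s₁ <;> cases s₂ <;> constructor

namespace CC

variable {Γ : Ctx}

theorem sort_type (hΓ : WfCtx CC Γ) (s : Srt) :
    Expr.sort s = .sort .box ∨ ∃ s', HasType CC Γ (.sort s) (.sort s') := by
  cases s with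
  | box => exact .inl rfl
  | star => exact .inr ⟨.box, .sort hΓ .mk⟩

theorem pi_inv {A B T : Expr} (h : HasType CC Γ (.pi A B) T) :
    ∃ s₁ s₂, HasType CC Γ A (.sort s₁) ∧ HasType CC (A :: Γ) B (.sort s₂) ∧
      Conv (.sort s₂) T := by
  obtain ⟨s₁, s₂, s₃, hA, hB, r, c⟩ := h.pi_inv
  cases CCRule.eq r
  exact ⟨s₁, s₂, hA, hB, c⟩

theorem pi {A B : Expr} {s₁ s₂ : Srt} (hA : HasType CC Γ A (.sort s₁))
    (hB : HasType CC (A :: Γ) B (.sort s₂)) : HasType CC Γ (.pi A B) (.sort s₂) :=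
  .pi hA hB (CCRule.intro _ _)

/-- The exception is unavoidable, since `□` itself has no type. It returns as a separate case
wherever the type of an expression is translated. -/
theorem type_correct {a A : Expr} (h : HasType CC Γ a A) :
    A = .sort .box ∨ ∃ s, HasType CC Γ A (.sort s) := by
  induction h using HasType.induction with
  | sort hΓ h => exact sort_type hΓ _
  | var hΓ h => exact .inr (hΓ.lookup h)
  | pi hA => exact sort_type hA.wfCtx _
  | lam h => exact .inr ⟨_, h⟩
  | app ha hb ih _ =>
    obtain ih | ⟨s, h⟩ := ih
    · cases ih
    · obtain ⟨s₁, s₂, hA, hB, -⟩ := pi_inv h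
      exact .inr ⟨s₂, hB.inst hb⟩
  | conv _ h => exact .inr ⟨_, h⟩

theorem type_correct_pi {a A B : Expr} (h : HasType CC Γ a (.pi A B)) :
    ∃ s₁ s₂, HasType CC Γ A (.sort s₁) ∧ HasType CC (A :: Γ) B (.sort s₂) := by
  obtain h | ⟨s, h⟩ := type_correct h
  · cases h
  · obtain ⟨s₁, s₂, hA, hB, -⟩ := pi_inv h
    exact ⟨s₁, s₂, hA, hB⟩

/-- Subject reduction. -/
theorem _root_.PureTS.HasType.step {a a' A : Expr} (h : HasType CC Γ a A) (r : Step a a') :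
    HasType CC Γ a' A := by
  induction h using HasType.induction generalizing a' with
  | sort => cases r
  | var => cases r
  | pi hA hB hr ihA ihB =>
    cases r with
    | pi1 r => exact .pi (ihA r) (hB.ctx_conv hA (ihA r) (.of_step r)) hr
    | pi2 r => exact .pi hA (ihB r) hr
  | lam h hb ih ihb =>
    cases r with
    | lam1 r =>
      -- The reduced abstraction naturally has the product over the reduced domain as its type;
      -- conversion brings back the original one.
      have h' := ih (.pi1 r)
      obtain ⟨s₁, s₂, hA, hB, -⟩ := pi_inv h
      obtain ⟨s₁', s₂', hA', -⟩ := pi_inv h'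
      exact .conv (.lam h' (hb.ctx_conv hA hA' (.of_step r))) h (.pi (.symm (.of_step r)) (.refl _))
    | lam2 r => exact .lam h (ihb r)
  | app ha hb iha ihb =>
    obtain ⟨s₁, s₂, hA, hB⟩ := type_correct_pi ha
    cases r with
    | beta A' b a =>
      -- The abstraction determines its product only up to conversion. Injectivity of products
      -- allows the argument to be retyped at the domain of the abstraction and the contractum at
      -- the expected codomain.
      obtain ⟨B', s, h, hb', c⟩ := ha.lam_inv
      obtain ⟨s₁', s₂', hA', hB', -⟩ := pi_inv h
      obtain ⟨cA, cB⟩ := c.pi_inj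
      exact .conv (hb'.inst (.conv hb hA' cA.symm)) (hB.inst hb) (cB.subst _)
    | app1 r => exact .app (iha r) hb
    | app2 r => exact .conv (.app ha (ihb r)) (hB.inst hb) (Conv.inst_step _ r).symm
  | conv _ hB c ih _ => exact .conv (ih r) hB c

theorem _root_.PureTS.HasType.red {a a' A : Expr} (h : HasType CC Γ a A) (r : Red a a') :
    HasType CC Γ a' A := by
  induction r with
  | refl => exact h
  | tail _ r ih => exact ih.step r

/-- The type is determined up to conversion because the axiom is functional and the sort of a
product is that of its codomain; the application case needs injectivity of products. -/
theorem unique {a A B : Expr} (h : HasType CC Γ a A) (h' : HasType CC Γ a B) : Conv A B := by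
  induction a generalizing Γ A B with
  | sort s =>
    obtain ⟨s₁, r, c⟩ := h.sort_inv
    obtain ⟨s₂, r', c'⟩ := h'.sort_inv
    cases r; cases r'
    exact c.symm.trans c'
  | var n =>
    obtain ⟨A₁, r, c⟩ := h.var_inv
    obtain ⟨A₂, r', c'⟩ := h'.var_inv
    cases r.unique r'
    exact c.symm.trans c'
  | pi C D _ ih =>
    obtain ⟨_, s, -, hD, c⟩ := pi_inv h
    obtain ⟨_, s', -, hD', c'⟩ := pi_inv h'
    cases (ih hD hD').sort_inj
    exact c.symm.trans c'
  | lam C b _ ih =>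
    obtain ⟨D, _, -, hb, c⟩ := h.lam_inv
    obtain ⟨D', _, -, hb', c'⟩ := h'.lam_inv
    exact c.symm.trans ((Conv.pi (.refl _) (ih hb hb')).trans c')
  | app f b ih _ =>
    obtain ⟨C, D, hf, -, c⟩ := h.app_inv
    obtain ⟨C', D', hf', -, c'⟩ := h'.app_inv
    exact c.symm.trans (((ih hf hf').pi_inj.2.subst _).trans c')

theorem sort_unique {a : Expr} {s s' : Srt} (h : HasType CC Γ a (.sort s))
    (h' : HasType CC Γ a (.sort s')) : s = s' :=
  (unique h h').sort_inj

/-- A common reduct has both sorts by subject reduction. Hence the conversion rule cannot move a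
type from one sort to the other, which makes the level of an expression well defined. -/
theorem sort_conv {A B : Expr} {s s' : Srt} (h : HasType CC Γ A (.sort s))
    (h' : HasType CC Γ B (.sort s')) (c : Conv A B) : s = s' := by
  obtain ⟨C, r, r'⟩ := c.church_rosser
  exact sort_unique (h.red r) (h'.red r')

theorem not_box {T : Expr} (h : HasType CC Γ (.sort .box) T) : False := by
  obtain ⟨s, r, -⟩ := h.sort_inv
  cases r

/-- Such an expression would reduce to `□`, which subject reduction would then make typable. -/
theorem not_conv_box {A T : Expr} (h : HasType CC Γ A T) (c : Conv A (.sort .box)) : False :=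
  not_box (h.red c.red_sort)

/-- The kinds are `∗` and the products over kinds. -/
theorem kind_inv {A : Expr} (h : HasType CC Γ A (.sort .box)) :
    A = .sort .star ∨ ∃ B C, A = .pi B C ∧ HasType CC (B :: Γ) C (.sort .box) := by
  cases A with
  | sort s =>
    obtain ⟨_, r, -⟩ := h.sort_inv
    cases r
    exact .inl rfl
  | var n =>
    obtain ⟨A, hA, c⟩ := h.var_inv
    obtain ⟨s, hA⟩ := h.wfCtx.lookup hA
    exact (not_conv_box hA c).elim
  | pi A B =>
    obtain ⟨_, s, -, hB, c⟩ := pi_inv h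
    cases c.sort_inj
    exact .inr ⟨A, B, rfl, hB⟩
  | lam A b =>
    obtain ⟨_, _, -, -, c⟩ := h.lam_inv
    exact c.symm.not_sort_pi.elim
  | app a b =>
    obtain ⟨_, _, ha, hb, c⟩ := h.app_inv
    obtain ⟨_, _, -, hB⟩ := type_correct_pi ha
    exact (not_conv_box (hB.inst hb) c).elim

end CC

/-! ### A syntactic presentation of the type translation -/

/-- Extend a sequence by a new first entry. -/
def scons {α : Type} (x : α) (f : ℕ → α) : ℕ → α
  | 0 => x
  | n + 1 => f n

/-- The expression is `∗` or a product that ends in `∗`.  Among the well-typed expressions these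
are the kinds. -/
def endsInStar : Expr → Bool
  | .sort .star => true
  | .pi _ B => endsInStar B
  | _ => false

/-- The level of an expression: `0` for terms, `1` for types and constructors, `2` for kinds, `3`
for `□`.  The constructor variables are those on which `c` is true. -/
def level : (ℕ → Bool) → Expr → ℕ
  | _, .sort .star => 2
  | _, .sort .box => 3
  | c, .var n => if c n then 1 else 0
  | c, .pi A B => level (scons (endsInStar A) c) B
  | c, .lam A b => level (scons (endsInStar A) c) b
  | c, .app a _ => level c a

/-- The function `V`, with a syntactic criterion for kinds. -/
def kindTr : Expr → Expr
  | .pi A B => if endsInStar A then arrow (kindTr A) (kindTr B) else kindTr B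
  | _ => .sort .star

/-- An environment for the type translation: which variables are constructor variables, the
translations of the variables, and the translation of sorts. -/
@[ext]
structure Env where
  kind : ℕ → Bool
  val : ℕ → Expr
  zero : Expr

namespace Env

/-- Add a variable to an environment. -/
def push (E : Env) (k : Bool) (t : Expr) : Env := ⟨scons k E.kind, scons t E.val, E.zero⟩

/-- Apply a substitution to the values of an environment. -/
def map (τ : ℕ → Expr) (E : Env) : Env := ⟨E.kind, fun n => subst τ (E.val n), subst τ E.zero⟩

/-- Weaken the values of an environment. -/
def shift (E : Env) : Env := ⟨E.kind, fun n => Expr.shift (E.val n), Expr.shift E.zero⟩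

/-- Rename the variables of an environment. -/
def comp (E : Env) (ξ : ℕ → ℕ) : Env := ⟨fun n => E.kind (ξ n), fun n => E.val (ξ n), E.zero⟩

/-- The environment under a binder.  A constructor variable is translated into two bindings; a term
variable has no translation and gets the value `∗`. -/
def under (E : Env) : Bool → Env
  | true => E.shift.shift.push true (.var 1)
  | false => E.shift.push false (.sort .star)

/-- The environment under an abstraction, where a constructor variable is translated into one
binding and a term variable into none. -/
def underLam (E : Env) : Bool → Env
  | true => E.shift.push true (.var 0)
  | false => E.push false (.sort .star)

end Env

/-- The type translation in an environment. -/
def tr : Env → Expr → Expr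
  | E, .sort _ => E.zero
  | E, .var n => E.val n
  | E, .pi A B =>
      if endsInStar A then .pi (kindTr A) (.pi (shift (tr E A)) (tr (E.under true) B))
      -- The default `∗` for a domain of level `0` never arises for well-typed products. It makes
      -- `tr_congr` hold for raw expressions, since such a domain could mention term variables.
      else .pi (if level E.kind A = 0 then .sort .star else tr E A) (tr (E.under false) B)
  | E, .lam A b =>
      if endsInStar A then .lam (kindTr A) (tr (E.underLam true) b)
      else tr (E.underLam false) b
  | E, .app a b => if level E.kind b = 1 then .app (tr E a) (tr E b) else tr E a

-- Levels and kinds under renaming and substitution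

theorem level_of_endsInStar {A : Expr} (h : endsInStar A = true) (c : ℕ → Bool) :
    level c A = 2 := by
  induction A generalizing c with
  | sort s => cases s <;> simp_all [endsInStar, level]
  | pi A B _ ih => exact ih h _
  | _ => cases h

theorem endsInStar_of_level_le {A : Expr} {c : ℕ → Bool} (h : level c A ≤ 1) :
    endsInStar A = false := by
  by_contra h'
  have := level_of_endsInStar (by simpa using h') c
  omega

@[simp]
theorem endsInStar_rename (ξ : ℕ → ℕ) (A : Expr) : endsInStar (rename ξ A) = endsInStar A := by
  induction A generalizing ξ with
  | pi A B _ ih => exact ih _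
  | _ => rfl

@[simp]
theorem endsInStar_shift (A : Expr) : endsInStar (shift A) = endsInStar A :=
  endsInStar_rename _ A

theorem endsInStar_subst {σ : ℕ → Expr} (hσ : ∀ n, endsInStar (σ n) = false) (A : Expr) :
    endsInStar (subst σ A) = endsInStar A := by
  induction A generalizing σ with
  | pi A B _ ih =>
    refine ih fun n => ?_
    cases n with
    | zero => rfl
    | succ n => exact (endsInStar_rename _ _).trans (hσ n)
  | var n => exact hσ n
  | _ => rfl

@[simp]
theorem level_rename (c : ℕ → Bool) (ξ : ℕ → ℕ) (A : Expr) :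
    level c (rename ξ A) = level (fun n => c (ξ n)) A := by
  have lift (k : Bool) (c : ℕ → Bool) (ξ : ℕ → ℕ) :
      (fun n => scons k c (liftRen ξ n)) = scons k fun n => c (ξ n) := by
    funext n; cases n <;> rfl
  induction A generalizing c ξ with
  | sort s => cases s <;> rfl
  | var n => rfl
  | app a b ih _ => exact ih _ _
  | pi A B _ ih => simp only [rename, level, endsInStar_rename, ih, lift]
  | lam A b _ ih => simp only [rename, level, endsInStar_rename, ih, lift]

theorem level_liftSub (k : Bool) {c : ℕ → Bool} {σ : ℕ → Expr} (hσ : ∀ n, level c (σ n) ≤ 1) :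
    ∀ n, level (scons k c) (liftSub σ n) ≤ 1
  | 0 => by cases k <;> simp [liftSub, level, scons]
  | n + 1 => (level_rename _ _ _).trans_le (hσ n)

theorem level_beq_liftSub (k : Bool) (c : ℕ → Bool) (σ : ℕ → Expr) :
    (fun n => level (scons k c) (liftSub σ n) == 1) = scons k fun n => level c (σ n) == 1 := by
  funext n
  cases n with
  | zero => cases k <;> rfl
  | succ n => simp only [liftSub, shift, level_rename]; rfl

/-- Variables have level `0` or `1`, so a Boolean records the level of what replaces them. The bound
excludes replacements of level `2` or `3`, which a Boolean could not record. -/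
theorem level_subst {c : ℕ → Bool} {σ : ℕ → Expr} (hσ : ∀ n, level c (σ n) ≤ 1) (A : Expr) :
    level c (subst σ A) = level (fun n => level c (σ n) == 1) A := by
  induction A generalizing c σ with
  | sort s => cases s <;> rfl
  | var n =>
    have := hσ n
    simp only [subst, level, beq_iff_eq]
    split <;> omega
  | pi A B _ ih =>
    simp only [subst, level, endsInStar_subst fun n => endsInStar_of_level_le (hσ n)]
    rw [ih (level_liftSub _ hσ), level_beq_liftSub]
  | lam A B _ ih =>
    simp only [subst, level, endsInStar_subst fun n => endsInStar_of_level_le (hσ n)]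
    rw [ih (level_liftSub _ hσ), level_beq_liftSub]
  | app a b ih _ => exact ih hσ

@[simp]
theorem subst_kindTr (σ : ℕ → Expr) (A : Expr) : subst σ (kindTr A) = kindTr A := by
  induction A generalizing σ with
  | pi A B hA hB =>
    simp only [kindTr]
    split
    · simp only [arrow, subst, subst_liftSub_shift, hA, hB]
    · exact hB σ
  | _ => rfl

@[simp]
theorem rename_kindTr (ξ : ℕ → ℕ) (A : Expr) : rename ξ (kindTr A) = kindTr A := by
  rw [rename_eq_subst, subst_kindTr]

@[simp]
theorem shift_kindTr (A : Expr) : shift (kindTr A) = kindTr A := rename_kindTr _ A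

@[simp]
theorem kindTr_rename (ξ : ℕ → ℕ) (A : Expr) : kindTr (rename ξ A) = kindTr A := by
  induction A generalizing ξ <;> simp_all [kindTr, rename]

@[simp]
theorem kindTr_shift (A : Expr) : kindTr (shift A) = kindTr A := kindTr_rename _ A

/-- The condition on `A` matters: a variable has the default value `∗`, while a product substituted
for it may have an arrow as its value. -/
theorem kindTr_subst {σ : ℕ → Expr} (hσ : ∀ n, endsInStar (σ n) = false) {A : Expr}
    (hA : endsInStar A = true) : kindTr (subst σ A) = kindTr A := by
  have lift {σ : ℕ → Expr} (hσ : ∀ n, endsInStar (σ n) = false) (n : ℕ) :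
      endsInStar (liftSub σ n) = false := by
    cases n with
    | zero => rfl
    | succ n => exact (endsInStar_rename _ _).trans (hσ n)
  induction A generalizing σ with
  | sort s => rfl
  | pi A B ihA ihB =>
    simp only [kindTr, subst, endsInStar_subst hσ]
    split
    · rw [ihA hσ ‹_›, ihB (lift hσ) hA]
    · exact ihB (lift hσ) hA
  | _ => cases hA

-- Environments under substitution in the target and renaming in the source

namespace Env

theorem push_map (τ : ℕ → Expr) (E : Env) (k : Bool) (t : Expr) :
    (E.push k t).map τ = (E.map τ).push k (subst τ t) := by
  ext n
  · rfl
  · cases n <;> rfl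
  · rfl

theorem push_comp (E : Env) (k : Bool) (t : Expr) (ξ : ℕ → ℕ) :
    (E.push k t).comp (liftRen ξ) = (E.comp ξ).push k t := by
  ext n
  · cases n <;> rfl
  · cases n <;> rfl
  · rfl

theorem shift_map (τ : ℕ → Expr) (E : Env) : E.shift.map (liftSub τ) = (E.map τ).shift := by
  simp only [shift, map, subst_liftSub_shift]

theorem shift_eq_map (E : Env) : E.shift = E.map fun n => .var (n + 1) := by
  simp only [shift, map, Expr.shift, rename_eq_subst, Nat.succ_eq_add_one]

theorem map_map (τ σ : ℕ → Expr) (E : Env) :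
    (E.map σ).map τ = E.map fun n => subst τ (σ n) := by
  simp only [map, subst_subst]

theorem shift_map_single (E : Env) (a : Expr) : E.shift.map (single a) = E := by
  rw [shift_eq_map, map_map]
  simp only [map, subst, single]
  change Env.mk _ (fun n => subst .var (E.val n)) (subst .var E.zero) = E
  simp only [subst_var]

theorem under_true_map (τ : ℕ → Expr) (E : Env) :
    (E.under true).map (liftSub (liftSub τ)) = (E.map τ).under true := by
  simp only [under, push_map, shift_map]; rfl

theorem under_false_map (τ : ℕ → Expr) (E : Env) :
    (E.under false).map (liftSub τ) = (E.map τ).under false := by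
  simp only [under, push_map, shift_map]; rfl

theorem underLam_true_map (τ : ℕ → Expr) (E : Env) :
    (E.underLam true).map (liftSub τ) = (E.map τ).underLam true := by
  simp only [underLam, push_map, shift_map]; rfl

theorem underLam_false_map (τ : ℕ → Expr) (E : Env) :
    (E.underLam false).map τ = (E.map τ).underLam false := by
  simp only [underLam, push_map]; rfl

theorem under_comp (E : Env) (k : Bool) (ξ : ℕ → ℕ) :
    (E.under k).comp (liftRen ξ) = (E.comp ξ).under k := by
  cases k <;> exact push_comp _ _ _ _

theorem underLam_comp (E : Env) (k : Bool) (ξ : ℕ → ℕ) :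
    (E.underLam k).comp (liftRen ξ) = (E.comp ξ).underLam k := by
  cases k <;> exact push_comp _ _ _ _

@[simp]
theorem kind_under (E : Env) (k : Bool) : (E.under k).kind = scons k E.kind := by
  cases k <;> rfl

@[simp]
theorem kind_underLam (E : Env) (k : Bool) : (E.underLam k).kind = scons k E.kind := by
  cases k <;> rfl

end Env

/-- The translation copies the values of its environment without inspecting them, so a substitution
in the target can be pushed into the environment. -/
theorem tr_map (τ : ℕ → Expr) (E : Env) (A : Expr) : tr (E.map τ) A = subst τ (tr E A) := by
  induction A generalizing E τ with
  | sort s => rfl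
  | var n => rfl
  | pi A B hA hB =>
    simp only [tr, ← Env.under_true_map, ← Env.under_false_map, hA, hB]
    split
    · simp only [subst, subst_kindTr, subst_liftSub_shift]
    · simp only [subst]
      rw [apply_ite (subst τ)]
      rfl
  | lam A b _ hb =>
    simp only [tr, ← Env.underLam_true_map, ← Env.underLam_false_map, hb]
    split
    · simp only [subst, subst_kindTr]
    · rfl
  | app a b ha hb =>
    simp only [tr, ha, hb]
    rw [apply_ite (subst τ)]
    rfl

theorem tr_shift (E : Env) (A : Expr) : tr E.shift A = shift (tr E A) := by
  rw [Env.shift_eq_map, tr_map, shift, rename_eq_subst]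

theorem tr_rename (E : Env) (ξ : ℕ → ℕ) (A : Expr) : tr E (rename ξ A) = tr (E.comp ξ) A := by
  induction A generalizing E ξ with
  | sort s => rfl
  | var n => rfl
  | pi A B hA hB =>
    simp only [rename, tr, endsInStar_rename, kindTr_rename, level_rename, hA, hB, Env.under_comp]
    rfl
  | lam A b _ hb =>
    simp only [rename, tr, endsInStar_rename, kindTr_rename, hb, Env.underLam_comp]
  | app a b ha hb =>
    simp only [rename, tr, level_rename, ha, hb]
    rfl

theorem tr_under_shift (E : Env) (A : Expr) :
    tr (E.under true) (shift A) = shift (shift (tr E A)) ∧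
      tr (E.under false) (shift A) = shift (tr E A) := by
  constructor
  · rw [← tr_shift, ← tr_shift, shift, tr_rename]; rfl
  · rw [← tr_shift, shift, tr_rename]; rfl

/-- The environment that reads the variables through a substitution. -/
def Env.sub (E : Env) (σ : ℕ → Expr) : Env :=
  ⟨fun n => level E.kind (σ n) == 1, fun n => tr E (σ n), E.zero⟩

theorem Env.under_sub (E : Env) (k : Bool) (σ : ℕ → Expr) :
    (E.under k).sub (liftSub σ) = (E.sub σ).under k := by
  refine Env.ext ?_ (funext fun n => ?_) ?_
  · simp only [Env.sub, Env.kind_under, level_beq_liftSub]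
  · cases n with
    | zero => cases k <;> rfl
    | succ n =>
      cases k
      · exact (tr_under_shift E (σ n)).2
      · exact (tr_under_shift E (σ n)).1
  · cases k <;> rfl

theorem Env.underLam_sub (E : Env) (k : Bool) (σ : ℕ → Expr) :
    (E.underLam k).sub (liftSub σ) = (E.sub σ).underLam k := by
  refine Env.ext ?_ (funext fun n => ?_) ?_
  · simp only [Env.sub, Env.kind_underLam, level_beq_liftSub]
  · cases n with
    | zero => cases k <;> rfl
    | succ n =>
      cases k
      · exact tr_rename _ _ _
      · exact (tr_rename _ _ _).trans (tr_shift E (σ n))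
  · cases k <;> rfl

/-- Substitution in the source amounts to another reading of the variables. The bound on levels
ensures that no binder and no application changes between its kept and its erased form. -/
theorem tr_subst {E : Env} {σ : ℕ → Expr} (hσ : ∀ n, level E.kind (σ n) ≤ 1) (A : Expr) :
    tr E (subst σ A) = tr (E.sub σ) A := by
  have hk {E : Env} {σ : ℕ → Expr} (hσ : ∀ n, level E.kind (σ n) ≤ 1) (k : Bool) :
      ∀ n, level (E.under k).kind (liftSub σ n) ≤ 1 := by
    rw [Env.kind_under]; exact level_liftSub k hσ
  have hk' {E : Env} {σ : ℕ → Expr} (hσ : ∀ n, level E.kind (σ n) ≤ 1) (k : Bool) :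
      ∀ n, level (E.underLam k).kind (liftSub σ n) ≤ 1 := by
    rw [Env.kind_underLam]; exact level_liftSub k hσ
  induction A generalizing E σ with
  | sort s => rfl
  | var n => rfl
  | pi A B hA hB =>
    have hσ' (n : ℕ) := endsInStar_of_level_le (hσ n)
    simp only [subst, tr, endsInStar_subst hσ', level_subst hσ, hA hσ, hB (hk hσ _),
      Env.under_sub]
    split
    · rw [kindTr_subst hσ' ‹_›]
    · rfl
  | lam A b _ hb =>
    have hσ' (n : ℕ) := endsInStar_of_level_le (hσ n)
    simp only [subst, tr, endsInStar_subst hσ', hb (hk' hσ _), Env.underLam_sub]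
    split
    · rw [kindTr_subst hσ' ‹_›]
    · rfl
  | app a b ha hb =>
    simp only [subst, tr, level_subst hσ, ha hσ, hb hσ]
    rfl

/-- The type translation of an expression that is not a term does not depend on the values of
term variables. -/
theorem tr_congr {E E' : Env} (hk : E.kind = E'.kind) (hz : E.zero = E'.zero)
    (hv : ∀ n, E.kind n = true → E.val n = E'.val n) {A : Expr} (hA : level E.kind A ≠ 0) :
    tr E A = tr E' A := by
  induction A generalizing E E' with
  | sort s => exact hz
  | var n =>
    refine hv n ?_
    by_contra h
    simp [level, h] at hA
  | pi A B ihA ihB =>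
    have hB (k : Bool) (h : endsInStar A = k) : tr (E.under k) B = tr (E'.under k) B := by
      refine ihB (by simp [hk]) ?_ ?_ (by simpa [h, level] using hA)
      · cases k <;> simp [Env.under, Env.push, Env.shift, hz]
      · rintro (_ | n) hn
        · cases k <;> rfl
        · simp only [Env.kind_under, scons] at hn
          cases k <;> simp [Env.under, Env.push, Env.shift, scons, hv n hn]
    simp only [tr, ← hk]
    split
    · rename_i h
      rw [hB _ h, ihA hk hz hv (by rw [level_of_endsInStar h]; decide)]
    · rename_i h
      rw [hB false (by simpa using h)]
      split
      · rfl
      · rename_i h'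
        rw [ihA hk hz hv h']
  | lam A b _ ihb =>
    have hB (k : Bool) (h : endsInStar A = k) : tr (E.underLam k) b = tr (E'.underLam k) b := by
      refine ihb (by simp [hk]) ?_ ?_ (by simpa [h, level] using hA)
      · cases k <;> simp [Env.underLam, Env.push, Env.shift, hz]
      · rintro (_ | n) hn
        · cases k <;> rfl
        · simp only [Env.kind_underLam, scons] at hn
          cases k <;> simp [Env.underLam, Env.push, Env.shift, scons, hv n hn]
    simp only [tr]
    split
    · rename_i h
      rw [hB _ h]
    · rename_i h
      rw [hB false (by simpa using h)]
  | app a b iha ihb =>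
    simp only [tr, ← hk]
    split
    · rename_i h
      rw [iha hk hz hv hA, ihb hk hz hv (by omega)]
    · exact iha hk hz hv hA

/-! ### Classification of the expressions of CC -/

/-- The environment of a context, with values over the translation of the context. -/
def env : Ctx → Env
  | [] => ⟨fun _ => false, fun _ => .sort .star, .var 1⟩
  | A :: Γ => (env Γ).under (endsInStar A)

@[simp]
theorem kind_env_cons (Γ : Ctx) (A : Expr) :
    (env (A :: Γ)).kind = scons (endsInStar A) (env Γ).kind := Env.kind_under _ _

theorem Lookup.kind_env {Γ : Ctx} {n : ℕ} {A : Expr} (h : Lookup Γ n A) :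
    (env Γ).kind n = endsInStar A := by
  induction h with
  | head => rw [kind_env_cons, endsInStar_shift]; rfl
  | tail _ _ ih => rw [kind_env_cons, endsInStar_shift, ← ih]; rfl

namespace CC

variable {Γ : Ctx}

theorem endsInStar_of_kind {A : Expr} (h : HasType CC Γ A (.sort .box)) :
    endsInStar A = true := by
  induction A generalizing Γ with
  | pi A B _ ih =>
    obtain h | ⟨_, _, h, hB⟩ := kind_inv h <;> cases h
    exact ih hB
  | _ => obtain h | ⟨_, _, h, -⟩ := kind_inv h <;> cases h <;> rfl

theorem endsInStar_of_type {A : Expr} (h : HasType CC Γ A (.sort .star)) :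
    endsInStar A = false := by
  induction A generalizing Γ with
  | sort s =>
    cases s with
    | star =>
      obtain ⟨_, r, c⟩ := h.sort_inv
      cases r
      cases c.sort_inj
    | box => rfl
  | pi A B _ ih =>
    obtain ⟨_, _, -, hB, c⟩ := pi_inv h
    cases c.sort_inj
    exact ih hB
  | _ => rfl

theorem endsInStar_iff {A : Expr} {s : Srt} (h : HasType CC Γ A (.sort s)) :
    endsInStar A = true ↔ s = .box := by
  cases s
  · simp [endsInStar_of_type h]
  · simp [endsInStar_of_kind h]

theorem endsInStar_congr {Δ : Ctx} {A B : Expr} {s : Srt} (h : HasType CC Γ A (.sort s))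
    (h' : HasType CC Δ B (.sort s)) : endsInStar A = endsInStar B := by
  rw [Bool.eq_iff_iff, endsInStar_iff h, endsInStar_iff h']

/-- The context quantified in `IsKind` is harmless, because the syntactic test does not mention a
context. -/
theorem isKind_iff {A : Expr} {s : Srt} (h : HasType CC Γ A (.sort s)) :
    IsKind A ↔ endsInStar A = true := by
  refine ⟨fun ⟨Δ, h'⟩ => endsInStar_of_kind h', fun h' => ⟨Γ, ?_⟩⟩
  rwa [(endsInStar_iff h).1 h'] at h

/-- `level` follows the body of a product or abstraction and the function of an application. At each
such passage the type stays in the same sort, by `sort_conv`; for a product, the case of a kind is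
excluded because its type `□` has no sort. -/
theorem level_eq {a A : Expr} (h : HasType CC Γ a A) :
    (A = .sort .box → level (env Γ).kind a = 2) ∧
      ∀ s, HasType CC Γ A (.sort s) →
        level (env Γ).kind a = if endsInStar A then 1 else 0 := by
  refine ⟨fun hA => level_of_endsInStar (endsInStar_of_kind (hA ▸ h)) _, fun t hA => ?_⟩
  induction a generalizing Γ A t with
  | sort s =>
    obtain ⟨_, r, c⟩ := h.sort_inv
    cases r
    exact (not_conv_box hA c.symm).elim
  | var n =>
    obtain ⟨A', hA', c⟩ := h.var_inv
    obtain ⟨s, h'⟩ := h.wfCtx.lookup hA'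
    cases sort_conv h' hA c
    simp only [level, hA'.kind_env, endsInStar_congr h' hA]
  | pi C D _ ih =>
    obtain ⟨_, s, hC, hD, c⟩ := pi_inv h
    cases s with
    | box => exact (not_conv_box hA c.symm).elim
    | star =>
      have hs {Γ : Ctx} (hΓ : WfCtx CC Γ) := HasType.sort (P := CC) hΓ StarBox.mk
      have := ih hD _ (hs hD.wfCtx)
      rw [kind_env_cons] at this
      cases sort_conv (hs h.wfCtx) hA c
      rw [level, this, ← endsInStar_congr (hs h.wfCtx) hA]
  | lam C b _ ih =>
    obtain ⟨D, s, hCD, hb, c⟩ := h.lam_inv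
    cases sort_conv hCD hA c
    obtain ⟨_, s', -, hD, -⟩ := pi_inv hCD
    have := ih hb _ hD
    rw [kind_env_cons] at this
    rw [level, this, ← endsInStar_congr hCD hA]
    rfl
  | app f b ih _ =>
    obtain ⟨C, D, hf, hb, c⟩ := h.app_inv
    obtain ⟨s₁, s, hC, hD⟩ := type_correct_pi hf
    cases sort_conv (hD.inst hb) hA c
    rw [level, ih hf _ (pi hC hD), ← endsInStar_congr (hD.inst hb) hA,
      endsInStar_congr (hD.inst hb) hD]
    rfl

theorem level_of_sort {A : Expr} {s : Srt} (h : HasType CC Γ A (.sort s)) :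
    level (env Γ).kind A ≠ 0 := by
  cases s with
  | box => simp [(level_eq h).1 rfl]
  | star => simp [(level_eq h).2 _ (.sort h.wfCtx .mk), endsInStar]

theorem level_le {a A : Expr} {s : Srt} (h : HasType CC Γ a A) (hA : HasType CC Γ A (.sort s)) :
    level (env Γ).kind a ≤ 1 := by
  rw [(level_eq h).2 _ hA]; split <;> omega

theorem level_eq_one_iff {a A : Expr} {s : Srt} (h : HasType CC Γ a A)
    (hA : HasType CC Γ A (.sort s)) : level (env Γ).kind a = 1 ↔ endsInStar A = true := by
  rw [(level_eq h).2 _ hA]; split <;> simp_all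

theorem level_step {a a' A : Expr} (h : HasType CC Γ a A) (r : Step a a') :
    level (env Γ).kind a = level (env Γ).kind a' := by
  obtain hA | ⟨s, hA⟩ := type_correct h
  · rw [(level_eq h).1 hA, (level_eq (h.step r)).1 hA]
  · rw [(level_eq h).2 _ hA, (level_eq (h.step r)).2 _ hA]

theorem isConstructor_iff {a A : Expr} {s : Srt} (h : HasType CC Γ a A)
    (hA : HasType CC Γ A (.sort s)) : IsConstructor Γ a ↔ level (env Γ).kind a = 1 := by
  constructor
  · rintro ⟨B, hB, hB'⟩
    exact (level_eq_one_iff hB hB').2 (endsInStar_of_kind hB')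
  · intro h'
    have hs := (endsInStar_iff hA).1 ((level_eq_one_iff h hA).1 h')
    exact ⟨A, h, hs ▸ hA⟩

theorem level_single {a A : Expr} {s : Srt} (h : HasType CC Γ a A)
    (hA : HasType CC Γ A (.sort s)) : ∀ n, level (env Γ).kind (single a n) ≤ 1
  | 0 => level_le h hA
  | n + 1 => by simp only [single, level]; split <;> omega

theorem V_eq {A : Expr} (h : HasType CC Γ A (.sort .box)) : V A = kindTr A := by
  induction A generalizing Γ with
  | pi A B ihA ihB =>
    obtain ⟨s, _, hA, hB, c⟩ := pi_inv h
    cases c.sort_inj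
    simp only [V, kindTr, isKind_iff hA, ihB hB]
    split
    · rename_i h
      rw [ihA ((endsInStar_iff hA).1 h ▸ hA)]
    · rfl
  | _ => rfl

/-- Equality holds, not only conversion: `kindTr` sees only which domains are kinds, and subject
reduction preserves this. -/
theorem kindTr_step {A A' : Expr} (h : HasType CC Γ A (.sort .box)) (r : Step A A') :
    kindTr A = kindTr A' := by
  induction A generalizing Γ A' with
  | pi A B ihA ihB =>
    obtain ⟨s, _, hA, hB, c⟩ := pi_inv h
    cases c.sort_inj
    cases r with
    | pi1 r =>
      simp only [kindTr, endsInStar_congr (hA.step r) hA]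
      split
      · rename_i h
        rw [ihA ((endsInStar_iff hA).1 h ▸ hA) r]
      · rfl
    | pi2 r => simp only [kindTr, ihB hB r]
  | _ =>
    obtain h | ⟨_, _, h, -⟩ := kind_inv h <;> cases h <;> cases r

theorem kindTr_red {A A' : Expr} (h : HasType CC Γ A (.sort .box)) (r : Red A A') :
    kindTr A = kindTr A' := by
  induction r with
  | refl => rfl
  | tail r r' ih => rw [ih, kindTr_step (h.red r) r']

theorem kindTr_conv {A B : Expr} (h : HasType CC Γ A (.sort .box))
    (h' : HasType CC Γ B (.sort .box)) (c : Conv A B) : kindTr A = kindTr B := by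
  obtain ⟨C, r, r'⟩ := c.church_rosser
  rw [kindTr_red h r, kindTr_red h' r']

/-! ### The type translation of CC in terms of the syntactic one -/

theorem width_eq {A : Expr} {s : Srt} (h : HasType CC Γ A (.sort s)) :
    width A = if endsInStar A then 2 else 1 := by
  simp only [width, isKind_iff h]

theorem zero_env (hΓ : WfCtx CC Γ) : (env Γ).zero = tyZero Γ := by
  induction Γ with
  | nil => rfl
  | cons A Γ ih =>
    obtain ⟨s, hA⟩ := hΓ.head
    simp only [tyZero, zeroIdx, width_eq hA, env] at ih ⊢
    cases endsInStar A <;> simp only [Env.under, Env.push, Env.shift, ih hΓ.tail] <;> rfl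

theorem val_env (hΓ : WfCtx CC Γ) {n : ℕ} {A : Expr} (h : Lookup Γ n A)
    (hn : (env Γ).kind n = true) : (env Γ).val n = .var (xIdx Γ n) := by
  induction h with
  | head Γ A =>
    obtain ⟨s, hA⟩ := hΓ.head
    have hk : endsInStar A = true := by rwa [kind_env_cons] at hn
    simp only [xIdx, isKind_iff hA, env, hk]; rfl
  | tail B h ih =>
    obtain ⟨s, hB⟩ := hΓ.head
    have ih := ih hΓ.tail (by rwa [kind_env_cons] at hn)
    simp only [xIdx, width_eq hB, env]
    cases endsInStar B <;> simp only [Env.under, Env.push, Env.shift, scons, ih] <;> rfl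

/-- No value in the environment mentions the innermost binding, `w^x` or the term variable `x`, so
deleting it only renumbers the others. -/
theorem lower_tr_under (E : Env) (k : Bool) (A : Expr) :
    lower (tr (E.under k) A) = tr (E.underLam k) A := by
  have h : (E.under k).map (fun n => .var n.pred) = E.underLam k := by
    cases k
    · simp only [Env.under, Env.underLam, Env.push_map, Env.shift_eq_map, Env.map_map]
      change Env.push (E.map .var) _ _ = _
      simp only [Env.map, subst_var]; rfl
    · simp only [Env.under, Env.underLam, Env.push_map, Env.shift_eq_map, Env.map_map]
      rfl
  rw [lower, rename_eq_subst, ← tr_map, h]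

/-- Terms are excluded because the two translations treat term variables differently: one keeps
their index, the other puts `∗`. -/
theorem typeTr_eq {A B : Expr} (h : HasType CC Γ A B) (hA : level (env Γ).kind A ≠ 0) :
    typeTr Γ A = tr (env Γ) A := by
  induction A generalizing Γ B with
  | sort s => exact (zero_env h.wfCtx).symm
  | var n =>
    obtain ⟨C, hC, -⟩ := h.var_inv
    refine (val_env h.wfCtx hC ?_).symm
    by_contra hn
    simp [level, hn] at hA
  | pi A B ihA ihB =>
    obtain ⟨s₁, s₂, h₁, h₂, -⟩ := pi_inv h
    simp only [typeTr, tr, isKind_iff h₁, ihA h₁ (level_of_sort h₁), ihB h₂ (level_of_sort h₂),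
      if_neg (level_of_sort h₁), env]
    split
    · rename_i hk
      rw [V_eq ((endsInStar_iff h₁).1 hk ▸ h₁), hk]
    · rename_i hk
      rw [Bool.eq_false_iff.2 hk]
  | lam A b _ ihb =>
    obtain ⟨B, s, hAB, hb, -⟩ := h.lam_inv
    obtain ⟨s₁, s₂, h₁, h₂, -⟩ := pi_inv hAB
    rw [level, ← kind_env_cons] at hA
    simp only [typeTr, tr, isKind_iff h₁, ihb hb hA, env, lower_tr_under]
    split
    · rename_i hk
      rw [V_eq ((endsInStar_iff h₁).1 hk ▸ h₁), hk]
    · rename_i hk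
      rw [Bool.eq_false_iff.2 hk]
  | app a b iha ihb =>
    obtain ⟨C, D, ha, hb, -⟩ := h.app_inv
    obtain ⟨_, _, hC, -⟩ := type_correct_pi ha
    simp only [typeTr, tr, isConstructor_iff hb hC, iha ha hA]
    split
    · rw [ihb hb (by omega)]
    · rfl

theorem typeTr_eq_of_sort {A : Expr} {s : Srt} (h : HasType CC Γ A (.sort s)) :
    typeTr Γ A = tr (env Γ) A :=
  typeTr_eq h (level_of_sort h)

/-! ### The type translation preserves reduction -/

theorem sub_single (E : Env) {a : Expr} {k : Bool} (h : (level E.kind a == 1) = k) :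
    E.sub (single a) = E.push k (tr E a) := by
  refine Env.ext (funext fun n => ?_) (funext fun n => ?_) rfl
  · cases n with
    | zero => exact h
    | succ n => cases h' : E.kind n <;> simp [Env.sub, Env.push, single, level, scons, h']
  · cases n <;> rfl

/-- The placeholder of a term variable may be replaced by any value. This is what identifies an
erased redex with its contractum. -/
theorem tr_underLam_false (E : Env) (t : Expr) {A : Expr}
    (hA : level (E.underLam false).kind A ≠ 0) :
    tr (E.underLam false) A = tr (E.push false t) A := by
  refine tr_congr (E := E.underLam false) (E' := E.push false t) rfl rfl ?_ hA
  rintro (_ | n) hn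
  · cases hn
  · rfl

/-- Only the classification of variables in `E` is tied to `Γ`. This generality is needed below an
abstraction, where `underLam` adds fewer bindings than the translated context does. -/
theorem tr_step {A A' B : Expr} (r : Step A A') (h : HasType CC Γ A B) {E : Env}
    (hE : E.kind = (env Γ).kind) (hA : level E.kind A ≠ 0) : Conv (tr E A) (tr E A') := by
  have hk {Γ : Ctx} {E : Env} (hE : E.kind = (env Γ).kind) (A : Expr) :
      (E.under (endsInStar A)).kind = (env (A :: Γ)).kind := by
    simp [hE]
  have hk' {Γ : Ctx} {E : Env} (hE : E.kind = (env Γ).kind) (A : Expr) :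
      (E.underLam (endsInStar A)).kind = (env (A :: Γ)).kind := by
    simp [hE]
  induction r generalizing Γ E B with
  | beta A b a =>
    obtain ⟨C, D, hf, ha, -⟩ := h.app_inv
    obtain ⟨D', s, hAD, hb, c⟩ := hf.lam_inv
    obtain ⟨_, _, hC, -⟩ := type_correct_pi hf
    obtain ⟨s₁, _, hA₁, hD', -⟩ := pi_inv hAD
    have ha := ha.conv hA₁ c.pi_inj.1.symm
    have hiff := level_eq_one_iff ha hA₁
    have hle := level_single ha hA₁
    rw [← hE] at hiff hle
    simp only [tr, hiff]
    rw [inst, tr_subst hle]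
    cases hA' : endsInStar A with
    | true =>
      rw [sub_single E (k := true) (by simp [hiff, hA'])]
      simp only [if_true]
      -- Contracting the translated redex gives the variable `0` the value `tr E a`, exactly what
      -- substitution in the source does.
      have : (E.underLam true).map (single (tr E a)) = E.push true (tr E a) := by
        simp only [Env.underLam, Env.push_map, Env.shift_map_single]; rfl
      rw [← this, tr_map]
      exact .of_step (.beta _ _ _)
    | false =>
      rw [sub_single E (k := false) (by simp [hiff, hA'])]
      simp only [Bool.false_eq_true, if_false]
      -- The abstraction and the argument are both erased. The two sides differ only in the value of
      -- a term variable, which is irrelevant above the level of terms.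
      have hb' : level (E.underLam false).kind b ≠ 0 := by simpa [level, hA'] using hA
      rw [tr_underLam_false E (tr E a) hb']
      exact .refl _
  | @pi1 A A' B' r ih =>
    obtain ⟨s₁, s₂, h₁, h₂, -⟩ := pi_inv h
    have hl := level_of_sort h₁
    have hl' := level_of_sort (h₁.step r)
    rw [← hE] at hl hl'
    have ih := ih h₁ hE hl
    simp only [tr, ← endsInStar_congr h₁ (h₁.step r), if_neg hl, if_neg hl']
    split
    · rename_i hk
      rw [kindTr_step ((endsInStar_iff h₁).1 hk ▸ h₁) r]
      exact .pi (.refl _) (.pi (ih.rename _) (.refl _))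
    · exact .pi ih (.refl _)
  | @pi2 A B' B'' r ih =>
    obtain ⟨s₁, s₂, h₁, h₂, -⟩ := pi_inv h
    have ih := ih h₂ (hk hE A) (by rw [hk hE A]; exact level_of_sort h₂)
    simp only [tr]
    split
    · rename_i hA
      rw [hA] at ih
      exact .pi (.refl _) (.pi (.refl _) ih)
    · rename_i hA
      rw [Bool.eq_false_iff.2 hA] at ih
      exact .pi (.refl _) ih
  | @lam1 A A' b r ih =>
    obtain ⟨B, s, hAB, hb, -⟩ := h.lam_inv
    obtain ⟨s₁, s₂, h₁, h₂, -⟩ := pi_inv hAB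
    simp only [tr, ← endsInStar_congr h₁ (h₁.step r)]
    split
    · rename_i hk
      rw [kindTr_step ((endsInStar_iff h₁).1 hk ▸ h₁) r]
      exact .refl _
    · exact .refl _
  | @lam2 A b b' r ih =>
    obtain ⟨B, s, hAB, hb, -⟩ := h.lam_inv
    have ih := ih hb (hk' hE A) (by rw [Env.kind_underLam]; exact hA)
    simp only [tr]
    split
    · rename_i hA
      rw [hA] at ih
      exact .lam (.refl _) ih
    · rename_i hA
      rw [Bool.eq_false_iff.2 hA] at ih
      exact ih
  | app1 r ih =>
    obtain ⟨C, D, ha, hb, -⟩ := h.app_inv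
    have ih := ih ha hE hA
    simp only [tr]
    split
    · exact .app ih (.refl _)
    · exact ih
  | app2 r ih =>
    obtain ⟨C, D, ha, hb, -⟩ := h.app_inv
    simp only [tr, hE ▸ level_step hb r]
    split
    · exact .app (.refl _) (ih hb hE (by rw [hE, level_step hb r, ← hE]; omega))
    · exact .refl _

theorem tr_red {A A' : Expr} {s : Srt} (r : Red A A') (h : HasType CC Γ A (.sort s)) :
    Conv (tr (env Γ) A) (tr (env Γ) A') := by
  induction r with
  | refl => exact .refl _
  | tail r r' ih => exact ih.trans (tr_step r' (h.red r) rfl (level_of_sort (h.red r)))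

theorem tr_conv {A B : Expr} {s s' : Srt} (h : HasType CC Γ A (.sort s))
    (h' : HasType CC Γ B (.sort s')) (c : Conv A B) : Conv (tr (env Γ) A) (tr (env Γ) B) := by
  obtain ⟨C, r, r'⟩ := c.church_rosser
  exact (tr_red r h).trans (tr_red r' h').symm

end CC

/-! ### Lookup in translated contexts -/

theorem lookup_zeroIdx (Γ : Ctx) : Lookup (ctxTr Γ) (zeroIdx Γ) (.sort .star) := by
  induction Γ with
  | nil => exact .tail _ (.head _ _)
  | cons A Γ ih =>
    simp only [ctxTr, zeroIdx, width]
    split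
    · exact .tail _ (.tail _ ih)
    · exact .tail _ ih

theorem lookup_zIdx (Γ : Ctx) : Lookup (ctxTr Γ) (zIdx Γ) (.pi (.sort .star) (.var 0)) := by
  induction Γ with
  | nil => exact .head _ _
  | cons A Γ ih =>
    simp only [ctxTr, zIdx, width]
    split
    · exact .tail _ (.tail _ ih)
    · exact .tail _ ih

namespace CC

variable {Γ : Ctx}

theorem ctxTr_cons {A : Expr} {s : Srt} (h : HasType CC Γ A (.sort s)) :
    ctxTr (A :: Γ) = if endsInStar A then shift (tr (env Γ) A) :: kindTr A :: ctxTr Γ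
      else tr (env Γ) A :: ctxTr Γ := by
  simp only [ctxTr, isKind_iff h, typeTr_eq_of_sort h]
  split
  · rename_i hk
    rw [V_eq ((endsInStar_iff h).1 hk ▸ h)]
  · rfl

theorem lookup_xIdx (hΓ : WfCtx CC Γ) {n : ℕ} {A : Expr} (h : Lookup Γ n A) :
    Lookup (ctxTr Γ) (xIdx Γ n) (if endsInStar A then kindTr A else tr (env Γ) A) := by
  induction h with
  | head Γ A =>
    obtain ⟨s, hA⟩ := hΓ.head
    simp only [ctxTr_cons hA, xIdx, isKind_iff hA, endsInStar_shift, kindTr_shift]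
    split
    · have := Lookup.tail (shift (tr (env Γ) A)) (.head (ctxTr Γ) (kindTr A))
      rwa [shift_kindTr, shift_kindTr] at this
    · rename_i hk
      rw [env, Bool.eq_false_iff.2 hk]
      exact (tr_under_shift (env Γ) A).2 ▸ .head _ _
  | @tail Γ n A B h ih =>
    obtain ⟨s, hB⟩ := hΓ.head
    have ih := ih hΓ.tail
    simp only [ctxTr_cons hB, xIdx, width_eq hB, endsInStar_shift, kindTr_shift, env]
    cases endsInStar B with
    | true =>
      have := Lookup.tail (shift (tr (env Γ) B)) (Lookup.tail (kindTr B) ih)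
      rw [apply_ite shift, apply_ite shift, ← (tr_under_shift (env Γ) A).1] at this
      simpa using this
    | false =>
      have := Lookup.tail (tr (env Γ) B) ih
      rw [apply_ite shift, ← (tr_under_shift (env Γ) A).2] at this
      simpa using this

theorem lookup_wIdx (hΓ : WfCtx CC Γ) {n : ℕ} {A : Expr} (h : Lookup Γ n A)
    (hA : endsInStar A = true) : Lookup (ctxTr Γ) (wIdx Γ n) (tr (env Γ) A) := by
  induction h with
  | head Γ A =>
    obtain ⟨s, h⟩ := hΓ.head
    rw [endsInStar_shift] at hA
    rw [ctxTr_cons h, wIdx, env, hA, (tr_under_shift _ _).1]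
    exact .head _ _
  | @tail Γ n A B h ih =>
    obtain ⟨s, hB⟩ := hΓ.head
    rw [endsInStar_shift] at hA
    have ih := ih hΓ.tail hA
    rw [ctxTr_cons hB, wIdx, env, width_eq hB]
    cases endsInStar B with
    | true => rw [(tr_under_shift _ _).1]; exact .tail _ (.tail _ ih)
    | false => rw [(tr_under_shift _ _).2]; exact .tail _ ih

end CC

/-! ### Soundness of the type translation -/

namespace Fomega

variable {Δ : Ctx}

theorem star (hΔ : WfCtx Fomega Δ) : HasType Fomega Δ (.sort .star) (.sort .box) :=
  .sort hΔ .mk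

theorem arrow_kind {A B : Expr} (hA : HasType Fomega Δ A (.sort .box))
    (hB : HasType Fomega Δ B (.sort .box)) : HasType Fomega Δ (arrow A B) (.sort .box) :=
  .pi hA (hB.weaken (.cons hA)) .bbb

theorem arrow_type {A B : Expr} (hA : HasType Fomega Δ A (.sort .star))
    (hB : HasType Fomega Δ B (.sort .star)) : HasType Fomega Δ (arrow A B) (.sort .star) :=
  .pi hA (hB.weaken (.cons hA)) .sss

theorem app_arrow {A B a b : Expr} (ha : HasType Fomega Δ a (arrow A B))
    (hb : HasType Fomega Δ b A) : HasType Fomega Δ (.app a b) B := by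
  have := HasType.app ha hb
  rwa [inst_shift] at this

theorem kindTr_kind (hΔ : WfCtx Fomega Δ) (A : Expr) :
    HasType Fomega Δ (kindTr A) (.sort .box) := by
  induction A with
  | pi A B hA hB =>
    simp only [kindTr]
    split
    · exact arrow_kind hA hB
    · exact hB
  | _ => exact star hΔ

theorem canonKind_type {i : ℕ} (hΔ : WfCtx Fomega Δ) (hi : Lookup Δ i (.sort .star)) (A : Expr) :
    HasType Fomega Δ (canonKind i (kindTr A)) (kindTr A) := by
  induction A generalizing Δ i with
  | pi A B _ hB =>
    simp only [kindTr]
    split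
    · have hA := kindTr_kind hΔ A
      simp only [arrow, canonKind, shift_kindTr]
      have hΔ' : WfCtx Fomega (kindTr A :: Δ) := .cons hA
      exact .lam (.pi hA (kindTr_kind hΔ' B) .bbb) (hB hΔ' (.tail _ hi))
    · exact hB hΔ hi
  | _ => exact .var hΔ hi

theorem canonType_type {Γ : Ctx} {B : Expr} (hB : HasType Fomega (ctxTr Γ) B (.sort .star)) :
    HasType Fomega (ctxTr Γ) (canonType Γ B) B :=
  .app (.var hB.wfCtx (lookup_zIdx Γ)) hB

theorem tyZero_type {Γ : Ctx} (hΓ : WfCtx Fomega (ctxTr Γ)) :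
    HasType Fomega (ctxTr Γ) (tyZero Γ) (.sort .star) :=
  .var hΓ (lookup_zeroIdx Γ)

end Fomega

namespace CC

variable {Γ : Ctx}

open Fomega

/-- A nonzero level leaves only kinds and `□` as types, and `□` is convertible to no typable
expression. -/
theorem kindTr_eq_of_conv {a A B : Expr} (hA : HasType CC Γ a A) (hB : HasType CC Γ a B)
    (c : Conv A B) (ha : level (env Γ).kind a ≠ 0) : kindTr A = kindTr B := by
  have kind {A : Expr} {s : Srt} (h : HasType CC Γ a A) (hA : HasType CC Γ A (.sort s)) :
      s = .box := by
    rw [(level_eq h).2 _ hA] at ha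
    exact (endsInStar_iff hA).1 (by simpa using ha)
  obtain rfl | ⟨s, h⟩ := type_correct hA <;> obtain rfl | ⟨s', h'⟩ := type_correct hB
  · rfl
  · exact (not_conv_box h' c.symm).elim
  · exact (not_conv_box h c).elim
  · cases kind hA h; cases kind hB h'
    exact kindTr_conv h h' c

theorem wfCtx_ctxTr_cons {A : Expr} {s : Srt} (h : HasType CC Γ A (.sort s))
    (hA : HasType Fomega (ctxTr Γ) (tr (env Γ) A) (.sort .star)) :
    WfCtx Fomega (ctxTr (A :: Γ)) := by
  rw [ctxTr_cons h]
  split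
  · exact .cons (hA.weaken (.cons (kindTr_kind hA.wfCtx A)))
  · exact .cons hA

/-- Since `w^x` does not occur, the substituted expression is arbitrary; instantiation merely
removes the binding. -/
theorem inst_tr_under_true (E : Env) (A c : Expr) :
    inst (tr (E.under true) A) c = tr (E.underLam true) A := by
  rw [inst, ← tr_map, Env.under, Env.push_map, Env.shift_map_single]; rfl

theorem inst_tr_under_false (E : Env) (A c : Expr) :
    inst (tr (E.under false) A) c = tr (E.underLam false) A := by
  rw [inst, ← tr_map, Env.under, Env.push_map, Env.shift_map_single]; rfl

/-- When `A` is a sort, `kindTr A` is `∗`, so types and kinds of CC both become types of Fω. This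
also yields the well-formedness of translated contexts. -/
theorem tr_type {a A : Expr} (h : HasType CC Γ a A) (hΓ : WfCtx Fomega (ctxTr Γ))
    (ha : level (env Γ).kind a ≠ 0) :
    HasType Fomega (ctxTr Γ) (tr (env Γ) a) (kindTr A) := by
  induction a generalizing Γ A with
  | sort s =>
    obtain ⟨_, r, c⟩ := h.sort_inv
    rw [← kindTr_eq_of_conv (.sort h.wfCtx r) h c ha, tr, zero_env h.wfCtx]
    exact tyZero_type hΓ
  | var n =>
    obtain ⟨B, hB, c⟩ := h.var_inv
    have hn : (env Γ).kind n = true := by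
      by_contra hn
      simp [level, hn] at ha
    rw [← kindTr_eq_of_conv (.var h.wfCtx hB) h c ha, tr, val_env h.wfCtx hB hn]
    have := lookup_xIdx h.wfCtx hB
    rw [← hB.kind_env, hn] at this
    exact .var hΓ this
  | pi C D ihC ihD =>
    obtain ⟨s₁, s₂, hC, hD, c⟩ := pi_inv h
    have hC' := ihC hC hΓ (level_of_sort hC)
    have hD' := ihD hD (wfCtx_ctxTr_cons hC hC') (level_of_sort hD)
    rw [← kindTr_eq_of_conv (pi hC hD) h c ha]
    rw [ctxTr_cons hC, env] at hD'
    simp only [tr, if_neg (level_of_sort hC)]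
    cases hk : endsInStar C with
    | true =>
      rw [hk] at hD'
      have hV := kindTr_kind hΓ C
      exact .pi hV (.pi (hC'.weaken (.cons hV)) hD' .sss) .bss
    | false =>
      rw [hk] at hD'
      exact .pi hC' hD' .sss
  | lam C b ihC ihb =>
    obtain ⟨D, s, hCD, hb, c⟩ := h.lam_inv
    obtain ⟨s₁, s₂, hC, hD, -⟩ := pi_inv hCD
    have hC' := ihC hC hΓ (level_of_sort hC)
    have hb' := ihb hb (wfCtx_ctxTr_cons hC hC') (by rwa [kind_env_cons])
    rw [← kindTr_eq_of_conv (.lam hCD hb) h c ha]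
    rw [ctxTr_cons hC, env] at hb'
    simp only [tr, kindTr]
    -- The body is typed under a binding that the translated abstraction lacks, `w^x` or the term
    -- variable `x`. The inhabitant `c^⟦C⟧` discharges it without affecting the body.
    have hc := canonType_type hC'
    cases hk : endsInStar C with
    | true =>
      rw [hk] at hb'
      have hV := kindTr_kind hΓ C
      have hΓ' : WfCtx Fomega (kindTr C :: ctxTr Γ) := .cons hV
      have := hb'.inst (hc.weaken hΓ')
      rw [inst_tr_under_true, inst, subst_kindTr] at this
      simp only [if_true, arrow, shift_kindTr]
      exact .lam (.pi hV (kindTr_kind hΓ' D) .bbb) this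
    | false =>
      rw [hk] at hb'
      have := hb'.inst hc
      rwa [inst_tr_under_false, inst, subst_kindTr] at this
  | app f b ihf ihb =>
    obtain ⟨C, D, hf, hb, c⟩ := h.app_inv
    obtain ⟨s₁, s₂, hC, hD⟩ := type_correct_pi hf
    have hf' := ihf hf hΓ ha
    rw [← kindTr_eq_of_conv (.app hf hb) h c ha]
    -- The function has the level of the application, which is not `0`, so its product type ends in
    -- `∗`. Hence the kind `kindTr D` is unaffected by the argument.
    have hD' : endsInStar D = true := by
      rw [level, (level_eq hf).2 _ (pi hC hD)] at ha
      by_contra hD'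
      exact ha (if_neg hD')
    rw [inst, kindTr_subst (fun n => endsInStar_of_level_le (level_single hb hC n)) hD']
    simp only [tr, kindTr, level_eq_one_iff hb hC] at hf' ⊢
    split
    · rename_i hk
      rw [if_pos hk] at hf'
      exact app_arrow hf' (ihb hb hΓ (by rw [(level_eq_one_iff hb hC).2 hk]; decide))
    · rename_i hk
      rwa [if_neg hk] at hf'

theorem wfCtx_ctxTr (hΓ : WfCtx CC Γ) : WfCtx Fomega (ctxTr Γ) := by
  induction Γ with
  | nil =>
    have h := Fomega.star WfCtx.nil
    exact .cons (.pi (Fomega.star (.cons h)) (.var (.cons (Fomega.star (.cons h))) (.head _ _)) .bss)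
  | cons A Γ ih =>
    obtain ⟨s, hA⟩ := hΓ.head
    exact wfCtx_ctxTr_cons hA (tr_type hA (ih hΓ.tail) (level_of_sort hA))

theorem tr_type_of_sort {A : Expr} {s : Srt} (h : HasType CC Γ A (.sort s)) :
    HasType Fomega (ctxTr Γ) (tr (env Γ) A) (.sort .star) :=
  tr_type h (wfCtx_ctxTr h.wfCtx) (level_of_sort h)

/-! ### Soundness of the term translation -/

/-- This absorbs the conversion in every generation lemma. The types need not have a sort: if one of
them is `□`, so is the other. -/
theorem tr_conv_type {a A B t : Expr} (hA : HasType CC Γ a A) (hB : HasType CC Γ a B)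
    (c : Conv A B) (ht : HasType Fomega (ctxTr Γ) t (tr (env Γ) A)) :
    HasType Fomega (ctxTr Γ) t (tr (env Γ) B) := by
  obtain rfl | ⟨s, h⟩ := type_correct hA <;> obtain rfl | ⟨s', h'⟩ := type_correct hB
  · exact ht
  · exact (not_conv_box h' c.symm).elim
  · exact (not_conv_box h c).elim
  · exact .conv ht (tr_type_of_sort h') (tr_conv h h' c)

/-- Stating the type with `tr` makes its behaviour under substitution available, and covers the case
where `A` is `□`. -/
theorem termTr_type {a A : Expr} (h : HasType CC Γ a A) :
    HasType Fomega (ctxTr Γ) (termTr Γ a) (tr (env Γ) A) := by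
  have hΓ := wfCtx_ctxTr h.wfCtx
  have hz := tyZero_type hΓ
  induction a generalizing Γ A with
  | sort s =>
    obtain ⟨_, r, c⟩ := h.sort_inv
    refine tr_conv_type (.sort h.wfCtx r) h c ?_
    rw [tr, zero_env h.wfCtx]
    exact canonType_type hz
  | var n =>
    obtain ⟨B, hB, c⟩ := h.var_inv
    refine tr_conv_type (.var h.wfCtx hB) h c ?_
    obtain ⟨s, hs⟩ := h.wfCtx.lookup hB
    have hv := HasType.var h.wfCtx hB
    simp only [termTr, isConstructor_iff hv hs, level_eq_one_iff hv hs]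
    split
    · exact .var hΓ (lookup_wIdx h.wfCtx hB ‹_›)
    · have := lookup_xIdx h.wfCtx hB
      rw [if_neg ‹_›] at this
      exact .var hΓ this
  | pi C D ihC ihD =>
    obtain ⟨s₁, s₂, hC, hD, c⟩ := pi_inv h
    refine tr_conv_type (pi hC hD) h c ?_
    have hΓ' := wfCtx_ctxTr hD.wfCtx
    have hC' := ihC hC hΓ hz
    have hD' := ihD hD hΓ' (tyZero_type hΓ')
    have hc := canonType_type (tr_type_of_sort hC)
    have hp : HasType Fomega (ctxTr Γ) (canonProd Γ) _ :=
      canonType_type (arrow_type hz (arrow_type hz hz))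
    rw [tr, zero_env h.wfCtx] at hC' ⊢
    simp only [termTr, isKind_iff hC, typeTr_eq_of_sort hC]
    rw [tr, env, ctxTr_cons hC] at hD'
    split
    · rename_i hk
      rw [hk] at hD'
      rw [V_eq ((endsInStar_iff hC).1 hk ▸ hC)]
      have hV := kindTr_kind hΓ C
      -- First `w^x`, then `x`, is replaced by its canonical inhabitant; the type `0` of the
      -- translated codomain depends on neither.
      have := (hD'.inst (hc.weaken (.cons hV))).inst (canonKind_type hΓ (lookup_zeroIdx Γ) C)
      simp only [Env.under, Env.push, Env.shift, inst_shift, zero_env h.wfCtx] at this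
      exact app_arrow (app_arrow hp hC') this
    · rename_i hk
      rw [Bool.eq_false_iff.2 hk] at hD'
      have := hD'.inst hc
      simp only [Env.under, Env.push, Env.shift, inst_shift, zero_env h.wfCtx] at this
      exact app_arrow (app_arrow hp hC') this
  | lam C b ihC ihb =>
    obtain ⟨D, s, hCD, hb, c⟩ := h.lam_inv
    obtain ⟨s₁, s₂, hC, hD, -⟩ := pi_inv hCD
    refine tr_conv_type (.lam hCD hb) h c ?_
    have hΓ' := wfCtx_ctxTr hD.wfCtx
    have hC' := ihC hC hΓ hz
    have hb' := ihb hb hΓ' (tyZero_type hΓ')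
    have hP := tr_type_of_sort hCD
    rw [tr, zero_env h.wfCtx] at hC'
    -- The variable `y` does not occur in `L`, so the redex that carries `[C]` along leaves the type
    -- unchanged. Both kinds of abstraction use this.
    have key {L : Expr} (hL : HasType Fomega (ctxTr Γ) L (tr (env Γ) (.pi C D))) :
        HasType Fomega (ctxTr Γ) (.app (.lam (tyZero Γ) (shift L)) (termTr Γ C))
          (tr (env Γ) (.pi C D)) :=
      app_arrow (.lam (arrow_type hz hP) (hL.weaken (.cons hz))) hC'
    simp only [termTr, isKind_iff hC, typeTr_eq_of_sort hC]
    rw [env, ctxTr_cons hC] at hb'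
    split
    · rename_i hk
      refine key ?_
      rw [hk] at hb'
      rw [V_eq ((endsInStar_iff hC).1 hk ▸ hC)]
      simp only [tr, hk, if_true] at hP ⊢
      obtain ⟨_, _, _, -, hP', -⟩ := hP.pi_inv
      exact .lam hP (.lam hP' hb')
    · rename_i hk
      refine key ?_
      rw [Bool.eq_false_iff.2 hk] at hb'
      simp only [tr, if_neg hk, if_neg (level_of_sort hC)] at hP ⊢
      exact .lam hP hb'
  | app f b ihf ihb =>
    obtain ⟨C, D, hf, hb, c⟩ := h.app_inv
    obtain ⟨s₁, s₂, hC, hD⟩ := type_correct_pi hf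
    refine tr_conv_type (.app hf hb) h c ?_
    have hf' := ihf hf hΓ hz
    have hb' := ihb hb hΓ hz
    have hiff := level_eq_one_iff hb hC
    have hD' := level_of_sort hD
    rw [kind_env_cons] at hD'
    simp only [termTr, isConstructor_iff hb hC, hiff]
    simp only [tr, if_neg (level_of_sort hC)] at hf'
    rw [inst, tr_subst (level_single hb hC)]
    split
    · rename_i hk
      have hl := hiff.2 hk
      have hl' : level (env Γ).kind b ≠ 0 := by omega
      rw [if_pos hk] at hf'
      have htb := tr_type hb hΓ hl'
      rw [typeTr_eq hb hl', sub_single _ (k := true) (by simp [hl])]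
      have := hf'.app htb
      change HasType _ _ _ (.pi (inst (shift (tr (env Γ) C)) _) (subst _ _)) at this
      rw [inst_shift] at this
      have := this.app hb'
      rw [inst, ← tr_map, ← tr_map] at this
      -- The two instantiations compose to an environment in which `x` has the value `⟦b⟧`; the term
      -- `[b]` put for `w^x` is never read.
      simpa only [Env.under, Env.push_map, Env.shift_map, Env.shift_map_single,
        subst, liftSub, single, subst_single_shift] using this
    · rename_i hk
      rw [if_neg hk] at hf'
      rw [sub_single _ (k := false) (by simpa [hiff] using hk)]
      rw [Bool.eq_false_iff.2 hk] at hD'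
      have := hf'.app hb'
      rw [inst_tr_under_false, tr_underLam_false _ (tr (env Γ) b) (by simpa using hD')] at this
      exact this

end CC

end PureTS

theorem mainTheorem4 (Γ : PureTS.Ctx) (a A : PureTS.Expr)
    (h : PureTS.HasType PureTS.CC Γ a A) :
    PureTS.HasType PureTS.Fomega (PureTS.ctxTr Γ) (PureTS.termTr Γ a) (PureTS.typeTr Γ A) := by
  have h' := PureTS.CC.termTr_type h
  -- The agreement of `typeTr` with `tr` is known for well-typed expressions; `□` has no type, and
  -- there both give the variable `0`.
  obtain rfl | ⟨s, hA⟩ := PureTS.CC.type_correct h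
  · rwa [PureTS.tr, PureTS.CC.zero_env h.wfCtx] at h'
  · rwa [PureTS.CC.typeTr_eq_of_sort hA]
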